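/- Let $V$ be a finite-dimensional real inner product space and let $G\subset GL(V)$ be a linear reductive Lie group, i.e. a closed subgroup with finitely many connected components that is stable under $g\mapsto g^{*}$ (adjoint). Let $\theta(g)=(g^{*})^{-1}$ be its Cartan involution, $K=\{g\in G:\theta(g)=g\}$, $\mathfrak p=\{X\in \mathrm{Lie}(G): X^{*}=X\}$, and fix a maximal abelian subspace $\mathfrak a\subset\mathfrak p$. Let $G_\theta=K\ltimes_{\mathrm{Ad}}\mathfrak p$ be the Cartan motion group, with multiplication $(k_1,X_1)(k_2,X_2)=(k_1k_2,\,X_1+\mathrm{Ad}(k_1)X_2)$, and let $\overline\theta(k,X)=(k,-X)$. Regard $K$ and $\mathfrak p$ as subgroups of $G_\theta$. For a subset $L\subset G_\theta$ put $\mathfrak a(L)=KLK\cap\mathfrak a$, and for a closed subgroup $L$ of $G_\theta$ put $d(L)=\dim L-\dim K_L$ where $K_L$ is a maximal compact subgroup of $L$. Let $H$ be a closed $\overline\theta$-stable subgroup of $G_\theta$ with at most finitely many connected components. Then the following two conditions are equivalent. (i) $G_\theta/H$ admits a compact Clifford–Klein form, i.e. there is a discrete subgroup $\Gamma$ of $G_\theta$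 that acts properly discontinuously and freely on $G_\theta/H$ and for which $\Gamma\backslash G_\theta/H$ is compact. (ii) There is a linear subspace $W\subset\mathfrak p$ such that $\mathfrak a(W)\cap\mathfrak a(H)=\{0\}$ and $\dim W+d(H)=d(G_\theta)$. -/

import Mathlib

open scoped Pointwise

noncomputable section

namespace CartanMotion

variable {V : Type*} [NormedAddCommGroup V] [InnerProductSpace ℝ V] [FiniteDimensional ℝ V]

/-- A linear reductive Lie group: a closed subgroup `G` of `GL(V)` with finitely many connected
components that is stable under taking adjoints with respect to the inner product of `V`. -/
structure IsLinearReductive (G : Subgroup (V →L[ℝ] V)ˣ) : Prop where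
  isClosed : IsClosed (G : Set (V →L[ℝ] V)ˣ)
  finite_components : Finite (ConnectedComponents G)
  star_mem : ∀ g ∈ G, star g ∈ G

/-- The Cartan involution `θ g = (g⋆)⁻¹` of `GL(V)`; it restricts to every self-adjoint `G`. -/
def theta : (V →L[ℝ] V)ˣ →* (V →L[ℝ] V)ˣ where
  toFun g := (star g)⁻¹
  map_one' := by simp
  map_mul' g h := by simp

/-- The Lie algebra of `G ≤ GL(V)`, as the tangent space at the identity: all velocities at time
`0` of curves in `G` through `1`. -/
def lieAlg (G : Subgroup (V →L[ℝ] V)ˣ) : Submodule ℝ (V →L[ℝ] V) where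
  carrier := {X | ∃ γ : ℝ → (V →L[ℝ] V)ˣ, (∀ t, γ t ∈ G) ∧ γ 0 = 1 ∧
    HasDerivAt (fun t => (γ t : V →L[ℝ] V)) X 0}
  zero_mem' := ⟨fun _ => 1, fun _ => G.one_mem, rfl, hasDerivAt_const _ _⟩
  add_mem' := by
    rintro X Y ⟨γ, hγ, hγ0, hX⟩ ⟨δ, hδ, hδ0, hY⟩
    refine ⟨fun t => γ t * δ t, fun t => G.mul_mem (hγ t) (hδ t), by simp [hγ0, hδ0], ?_⟩
    have h := hX.mul hY
    simp only [hγ0, hδ0, Units.val_one, mul_one, one_mul] at h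
    exact h
  smul_mem' := by
    rintro c X ⟨γ, hγ, hγ0, hX⟩
    refine ⟨fun t => γ (c * t), fun t => hγ _, by simp [hγ0], ?_⟩
    have h1 : HasDerivAt (fun t : ℝ => c * t) c 0 := by
      simpa using (hasDerivAt_id (0 : ℝ)).const_mul c
    have h2 : HasDerivAt (fun t => (γ t : V →L[ℝ] V)) X (c * 0) := by simpa using hX
    exact h2.scomp (0 : ℝ) h1

/-- The maximal compact subgroup `K = {g ∈ G | θ g = g}`. -/
def cartanK (G : Subgroup (V →L[ℝ] V)ˣ) : Subgroup (V →L[ℝ] V)ˣ where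
  carrier := {g | g ∈ G ∧ theta g = g}
  one_mem' := ⟨G.one_mem, map_one _⟩
  mul_mem' := by
    rintro a b ⟨ha, ha'⟩ ⟨hb, hb'⟩
    exact ⟨G.mul_mem ha hb, by rw [map_mul, ha', hb']⟩
  inv_mem' := by
    rintro a ⟨ha, ha'⟩
    exact ⟨G.inv_mem ha, by rw [map_inv, ha']⟩

/-- The `-1` eigenspace `𝔭` of `dθ : X ↦ -X⋆` on the Lie algebra of `G`. -/
def cartanP (G : Subgroup (V →L[ℝ] V)ˣ) : Submodule ℝ (V →L[ℝ] V) where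
  carrier := {X | X ∈ lieAlg G ∧ -star X = -X}
  zero_mem' := ⟨(lieAlg G).zero_mem, by simp⟩
  add_mem' := by
    rintro X Y ⟨hX, hX'⟩ ⟨hY, hY'⟩
    refine ⟨(lieAlg G).add_mem hX hY, ?_⟩
    rw [neg_inj] at *
    rw [star_add, hX', hY']
  smul_mem' := by
    rintro c X ⟨hX, hX'⟩
    refine ⟨(lieAlg G).smul_mem c hX, ?_⟩
    rw [neg_inj] at *
    rw [star_smul, hX']
    simp

theorem conj_mem_cartanP {G : Subgroup (V →L[ℝ] V)ˣ} (k : cartanK G) {X : V →L[ℝ] V}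
    (hX : X ∈ cartanP G) :
    ((k : (V →L[ℝ] V)ˣ) : V →L[ℝ] V) * X * ((k⁻¹ : (V →L[ℝ] V)ˣ) : V →L[ℝ] V) ∈ cartanP G := by
  obtain ⟨⟨γ, hγ, hγ0, hd⟩, hs⟩ := hX
  obtain ⟨k, hkG, hk⟩ := k
  refine ⟨⟨fun t => k * γ t * k⁻¹, fun t => G.mul_mem (G.mul_mem hkG (hγ t)) (G.inv_mem hkG),
    by simp [hγ0], ?_⟩, ?_⟩
  · simpa using (hd.const_mul (k : V →L[ℝ] V)).mul_const ((k⁻¹ : (V →L[ℝ] V)ˣ) : V →L[ℝ] V)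
  · have h1 : star k = k⁻¹ := by
      have : (star k)⁻¹ = k := hk
      rw [← this, inv_inv, this]
    have h2 : star (k : V →L[ℝ] V) = ((k⁻¹ : (V →L[ℝ] V)ˣ) : V →L[ℝ] V) := by
      rw [← h1]; rfl
    have h3 : star ((k⁻¹ : (V →L[ℝ] V)ˣ) : V →L[ℝ] V) = (k : V →L[ℝ] V) := by
      rw [← h2, star_star]
    rw [neg_inj] at hs ⊢
    simp only [star_mul, h2, h3, hs, mul_assoc]

/-- The adjoint representation `Ad(k) X = k X k⁻¹` of `K` on `𝔭`. -/
def Ad (G : Subgroup (V →L[ℝ] V)ˣ) : cartanK G →* Module.End ℝ (cartanP G) where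
  toFun k :=
    { toFun := fun X => ⟨_, conj_mem_cartanP k X.2⟩
      map_add' := fun X Y => Subtype.ext (by simp [mul_add, add_mul])
      map_smul' := fun c X => Subtype.ext (by simp) }
  map_one' := by
    ext1 X
    exact Subtype.ext (by simp)
  map_mul' k l := by
    ext1 X
    exact Subtype.ext (by simp [mul_assoc])

/-- The Cartan motion group `G_θ = K ⋉ 𝔭` of `G`. -/
@[ext]
structure MotionGroup (G : Subgroup (V →L[ℝ] V)ˣ) where
  k : cartanK G
  X : cartanP G

namespace MotionGroup

variable {G : Subgroup (V →L[ℝ] V)ˣ}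

/-- `(k₁, X₁) (k₂, X₂) = (k₁ k₂, X₁ + Ad(k₁) X₂)`. -/
instance : Mul (MotionGroup G) := ⟨fun a b => ⟨a.k * b.k, a.X + Ad G a.k b.X⟩⟩

instance : One (MotionGroup G) := ⟨⟨1, 0⟩⟩

instance : Inv (MotionGroup G) := ⟨fun a => ⟨a.k⁻¹, -Ad G a.k⁻¹ a.X⟩⟩

@[simp] theorem mul_k (a b : MotionGroup G) : (a * b).k = a.k * b.k := rfl

@[simp] theorem mul_X (a b : MotionGroup G) : (a * b).X = a.X + Ad G a.k b.X := rfl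

@[simp] theorem one_k : (1 : MotionGroup G).k = 1 := rfl

@[simp] theorem one_X : (1 : MotionGroup G).X = 0 := rfl

@[simp] theorem inv_k (a : MotionGroup G) : (a⁻¹).k = a.k⁻¹ := rfl

@[simp] theorem inv_X (a : MotionGroup G) : (a⁻¹).X = -Ad G a.k⁻¹ a.X := rfl

instance : Group (MotionGroup G) :=
  Group.ofLeftAxioms
    (fun a b c => by
      ext1
      · simp [mul_assoc]
      · simp [map_mul, add_assoc])
    (fun a => by ext1 <;> simp)
    (fun a => by ext1 <;> simp)

/-- The topology of `K × 𝔭`. -/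
instance : TopologicalSpace (MotionGroup G) :=
  TopologicalSpace.induced (fun a => (a.k, a.X)) inferInstance

theorem continuous_pair : Continuous fun a : MotionGroup G => (a.k, a.X) :=
  continuous_induced_dom

theorem continuous_Ad : Continuous fun q : cartanK G × cartanP G => Ad G q.1 q.2 := by
  refine Continuous.subtype_mk (f := fun q : cartanK G × cartanP G =>
    ((q.1 : (V →L[ℝ] V)ˣ) : V →L[ℝ] V) * (q.2 : V →L[ℝ] V) *
      ((q.1⁻¹ : (V →L[ℝ] V)ˣ) : V →L[ℝ] V)) ?_ _
  refine ((Units.continuous_val.comp (continuous_subtype_val.comp continuous_fst)).mul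
    (continuous_subtype_val.comp continuous_snd)).mul ?_
  exact Units.continuous_val.comp (continuous_inv.comp (continuous_subtype_val.comp continuous_fst))

instance : IsTopologicalGroup (MotionGroup G) where
  continuous_mul := by
    have hk : Continuous fun a : MotionGroup G => a.k := continuous_pair.fst
    have hX : Continuous fun a : MotionGroup G => a.X := continuous_pair.snd
    refine continuous_induced_rng.2 (Continuous.prodMk ?_ ?_)
    · exact (hk.comp continuous_fst).mul (hk.comp continuous_snd)
    · exact (hX.comp continuous_fst).add (continuous_Ad.comp
        ((hk.comp continuous_fst).prodMk (hX.comp continuous_snd)))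
  continuous_inv := by
    have hk : Continuous fun a : MotionGroup G => a.k := continuous_pair.fst
    have hX : Continuous fun a : MotionGroup G => a.X := continuous_pair.snd
    refine continuous_induced_rng.2 (Continuous.prodMk hk.inv ?_)
    exact (continuous_Ad.comp (hk.inv.prodMk hX)).neg

/-- The involution `(k, X) ↦ (k, -X)` of `G_θ`. -/
def thetaBar : MotionGroup G →* MotionGroup G where
  toFun a := ⟨a.k, -a.X⟩
  map_one' := by ext1 <;> simp
  map_mul' a b := by ext1 <;> simp [add_comm]

/-- `K` as a subset of `G_θ`. -/
def setK (G : Subgroup (V →L[ℝ] V)ˣ) : Set (MotionGroup G) :=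
  {a | a.X = 0}

/-- The inclusion of `𝔭` in `G_θ`. -/
def ofP (X : cartanP G) : MotionGroup G := ⟨1, X⟩

theorem coe_inv_k (a : MotionGroup G) :
    (((a.k : (V →L[ℝ] V)ˣ)⁻¹ : (V →L[ℝ] V)ˣ) : V →L[ℝ] V) =
      star ((a.k : (V →L[ℝ] V)ˣ) : V →L[ℝ] V) := by
  have h : (star (a.k : (V →L[ℝ] V)ˣ))⁻¹ = a.k := a.k.2.2
  rw [← Units.coe_star, ← h, inv_inv, h]

/-- The tangent space at the identity of a subgroup `H` of `G_θ`: all velocities at time `0` of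
curves in `H` through `1`, where `G_θ = K × 𝔭` is seen as a submanifold of `End(V) × End(V)`. -/
def tangentSpace (H : Subgroup (MotionGroup G)) :
    Submodule ℝ ((V →L[ℝ] V) × (V →L[ℝ] V)) where
  carrier := {v | ∃ γ : ℝ → MotionGroup G, (∀ t, γ t ∈ H) ∧ γ 0 = 1 ∧
    HasDerivAt (fun t => (((γ t).k : (V →L[ℝ] V)ˣ) : V →L[ℝ] V)) v.1 0 ∧
    HasDerivAt (fun t => ((γ t).X : V →L[ℝ] V)) v.2 0}
  zero_mem' := ⟨fun _ => 1, fun _ => H.one_mem, rfl, hasDerivAt_const _ _, hasDerivAt_const _ _⟩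
  add_mem' := by
    rintro v w ⟨γ, hγ, hγ0, hv1, hv2⟩ ⟨δ, hδ, hδ0, hw1, hw2⟩
    refine ⟨fun t => γ t * δ t, fun t => H.mul_mem (hγ t) (hδ t), by simp [hγ0, hδ0], ?_, ?_⟩
    · have h := hv1.mul hw1
      simp only [hγ0, hδ0, one_k, OneMemClass.coe_one, Units.val_one, mul_one, one_mul] at h
      exact h
    · have h := hv2.add ((hv1.mul hw2).mul hv1.star)
      simp only [hγ0, hδ0, one_k, one_X, OneMemClass.coe_one, Units.val_one, mul_one, one_mul,
        ZeroMemClass.coe_zero, mul_zero, zero_mul, zero_add, star_one, Pi.mul_apply,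
        add_zero] at h
      refine h.congr_of_eventuallyEq (Filter.Eventually.of_forall fun t => ?_)
      have hc := coe_inv_k (γ t)
      change ((γ t).X : V →L[ℝ] V) + _ * _ * _ = _
      rw [hc]
      rfl
  smul_mem' := by
    rintro c v ⟨γ, hγ, hγ0, hv1, hv2⟩
    have h1 : HasDerivAt (fun t : ℝ => c * t) c 0 := by
      simpa using (hasDerivAt_id (0 : ℝ)).const_mul c
    rw [← mul_zero c] at hv1 hv2
    exact ⟨fun t => γ (c * t), fun t => hγ _, by simp [hγ0],
      hv1.scomp (0 : ℝ) h1, hv2.scomp (0 : ℝ) h1⟩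

/-- The dimension of a closed subgroup `H` of `G_θ` as a Lie group. -/
def lieDim (H : Subgroup (MotionGroup G)) : ℕ := Module.finrank ℝ (tangentSpace H)

/-- `C` is a maximal compact subgroup of `H`. -/
def IsMaximalCompact (H C : Subgroup (MotionGroup G)) : Prop :=
  Maximal (fun D : Subgroup (MotionGroup G) => D ≤ H ∧ IsCompact (D : Set (MotionGroup G))) C

open Classical in
/-- The non-compact dimension `d(H) = dim H - dim C`, where `C` is a maximal compact subgroup
of `H` (any two of them are conjugate). -/
def noncompactDim (H : Subgroup (MotionGroup G)) : ℕ :=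
  if h : ∃ C, IsMaximalCompact H C then lieDim H - lieDim h.choose else 0

/-- `𝔞` is a maximal abelian subspace of `𝔭`. -/
def IsMaximalAbelian (𝔞 : Submodule ℝ (cartanP G)) : Prop :=
  Maximal (fun 𝔟 : Submodule ℝ (cartanP G) =>
    ∀ X ∈ 𝔟, ∀ Y ∈ 𝔟, ⁅(X : V →L[ℝ] V), (Y : V →L[ℝ] V)⁆ = 0) 𝔞

/-- `𝔞(L) = K L K ∩ 𝔞` for a subset `L` of `G_θ`. -/
def aPart (𝔞 : Submodule ℝ (cartanP G)) (L : Set (MotionGroup G)) : Set (cartanP G) :=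
  {X | X ∈ 𝔞 ∧ ofP X ∈ setK G * L * setK G}

end MotionGroup

/-- `E / H` admits a compact Clifford–Klein form: some discrete subgroup `Γ` of `E` acts properly
discontinuously and freely on `E / H` with compact quotient. -/
def HasCompactCliffordKleinForm {E : Type*} [Group E] [TopologicalSpace E] (H : Subgroup E) :
    Prop :=
  ∃ Γ : Subgroup E, DiscreteTopology Γ ∧
    ProperlyDiscontinuousSMul Γ (E ⧸ H) ∧
    (∀ (γ : Γ) (x : E ⧸ H), γ • x = x → γ = 1) ∧
    CompactSpace (MulAction.orbitRel.Quotient Γ (E ⧸ H))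

end CartanMotion

end

/-!
Write `G_θ = K ⋉ 𝔭`, where `K` is compact and acts on `𝔭` by isometries of the trace form.

*Structure of `H`.* If `(k, X) ∈ H`, stability under `(k, X) ↦ (k, -X)` gives `(1, 2X) ∈ H`, and
finiteness of the number of components excludes lattice directions in `H ∩ 𝔭`. Hence `H = (H ∩ K)
⋉ P` with a linear subspace `P ⊂ 𝔭` (`exists_isSplit`). A compact subgroup of `H` fixes a point of
`P`, so every maximal compact subgroup is conjugate to `H ∩ K` and `d(H) = dim P`
(`IsSplit.noncompactDim_eq`).

*The condition on `𝔞`.* Every element of `𝔭` is `K`-conjugate into `𝔞` (`exists_Ad_mem`): choose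
`H₀` regular in `𝔞` and maximize `k ↦ tr (Ad(k) X · H₀)`. Therefore `𝔞(W) ∩ 𝔞(H) = {0}` means that
`Ad(k) W ∩ P = 0` for every `k ∈ K` (`aPart_inter_aPart_eq_iff`).

*From `W` to `Γ`.* Take for `Γ` the translations by a lattice of `W`. By compactness of `K`, the
transversality is uniform, which gives properness and freeness; since `𝔭 = W ⊕ Ad(k) P` for each
`k`, the action is cocompact (`hasCompactCliffordKleinForm_of_complement`).

*From `Γ` to `W`.* The main step is a statement in the spirit of Bieberbach's first theorem: the
translation parts of a discrete group `Γ` of Euclidean motions lie at bounded Hausdorff distance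
from a linear subspace `W` (`DiscreteIsometry.exists_submodule_near_orbit`). Elements with
rotational part near `1` have commuting rotational parts, since their iterated commutators tend to
the identity and so reach it by discreteness. The same argument shows that the translations in `Γ`
lie in the common fixed space `F` of these rotations, while commutators are translations without
component in `F`, hence trivial. This bounds the components of the translation parts orthogonal to
`F`, and the components in `F` are additive. Finitely many cosets of such elements cover `Γ`, by
compactness of the orthogonal group. Properness of the action of `Γ` then forces `Ad(k) W ∩ P = 0`
for all `k`, and cocompactness forces `W + P = 𝔭`
(`exists_complement_of_hasCompactCliffordKleinForm`).
-/

/-! ### Orbits of discrete groups of isometries of a Euclidean space -/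

namespace DiscreteIsometry

open Filter Topology
open scoped commutatorElement

/-- A normed algebra has no small multiplicative subgroups: the identity
`D ^ (2n) - 1 = 2 (D ^ n - 1) + (D ^ n - 1) ^ 2` doubles the distance to `1`. -/
theorem eq_one_of_norm_pow_sub_one_le {A : Type*} [NormedRing A] [NormedAlgebra ℝ A] {D : A}
    {c : ℝ} (hc : c < 1) (h : ∀ n : ℕ, ‖D ^ n - 1‖ ≤ c) : D = 1 := by
  have hb : BddAbove (Set.range fun n : ℕ => ‖D ^ n - 1‖) := ⟨c, by rintro _ ⟨n, rfl⟩; exact h n⟩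
  set s := ⨆ n : ℕ, ‖D ^ n - 1‖ with hs
  have key : ∀ n : ℕ, ‖D ^ n - 1‖ ≤ s / (2 - c) := by
    intro n
    have e : (2 : ℝ) • (D ^ n - 1) = (D ^ (n * 2) - 1) - (D ^ n - 1) * (D ^ n - 1) := by
      rw [two_smul, pow_mul, sq]; noncomm_ring
    have h1 : 2 * ‖D ^ n - 1‖ ≤ s + c * ‖D ^ n - 1‖ := by
      calc 2 * ‖D ^ n - 1‖ = ‖(2 : ℝ) • (D ^ n - 1)‖ := by rw [norm_smul]; norm_num
        _ ≤ ‖D ^ (n * 2) - 1‖ + ‖(D ^ n - 1) * (D ^ n - 1)‖ := by rw [e]; exact norm_sub_le _ _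
        _ ≤ s + c * ‖D ^ n - 1‖ := by
          gcongr
          · exact le_ciSup hb (n * 2)
          · exact (norm_mul_le _ _).trans (by gcongr; exact h n)
    rw [le_div_iff₀ (by linarith)]
    linarith
  have h2 : s ≤ s / (2 - c) := ciSup_le key
  have h3 : s ≤ 0 := by
    rw [le_div_iff₀ (by linarith)] at h2
    nlinarith
  have h4 : ‖D ^ 1 - 1‖ ≤ 0 := (le_ciSup hb 1).trans h3
  rw [pow_one] at h4
  exact sub_eq_zero.1 (norm_le_zero_iff.1 h4)

variable {E : Type*} [NormedAddCommGroup E] [InnerProductSpace ℝ E]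
  {Γ : Type*} [Group Γ] {ρ : Γ →* (E →L[ℝ] E)} {x : Γ → E}

theorem norm_map_eq (hρ : ∀ g v w, inner ℝ (ρ g v) (ρ g w) = inner ℝ v w) (g : Γ) (v : E) :
    ‖ρ g v‖ = ‖v‖ := by
  rw [← sq_eq_sq₀ (norm_nonneg _) (norm_nonneg _), ← real_inner_self_eq_norm_sq, hρ,
    real_inner_self_eq_norm_sq]

theorem norm_map_le_one (hρ : ∀ g v w, inner ℝ (ρ g v) (ρ g w) = inner ℝ v w) (g : Γ) :
    ‖ρ g‖ ≤ 1 :=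
  ContinuousLinearMap.opNorm_le_bound _ zero_le_one fun v => by rw [norm_map_eq hρ, one_mul]

theorem map_mul_inv_apply (g : Γ) (v : E) : ρ g (ρ g⁻¹ v) = v := by
  rw [← mul_apply_eq_comp, ← map_mul, mul_inv_cancel, map_one]; rfl

theorem norm_map_inv_sub_one_le (hρ : ∀ g v w, inner ℝ (ρ g v) (ρ g w) = inner ℝ v w) (a : Γ) :
    ‖ρ a⁻¹ - 1‖ ≤ ‖ρ a - 1‖ := by
  have e : ρ a⁻¹ - 1 = -(ρ a⁻¹ * (ρ a - 1)) := by
    rw [mul_sub, ← map_mul, inv_mul_cancel, map_one, mul_one]; abel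
  rw [e, norm_neg]
  exact (norm_mul_le _ _).trans
    (mul_le_of_le_one_left (norm_nonneg _) (norm_map_le_one hρ _))

theorem norm_map_commutator_sub_one_le
    (hρ : ∀ g v w, inner ℝ (ρ g v) (ρ g w) = inner ℝ v w) (a b : Γ) :
    ‖ρ ⁅a, b⁆ - 1‖ ≤ 2 * ‖ρ a - 1‖ * ‖ρ b - 1‖ := by
  have e : ρ ⁅a, b⁆ - 1 =
      ((ρ a - 1) * (ρ b - 1) - (ρ b - 1) * (ρ a - 1)) * ρ (a⁻¹ * b⁻¹) := by
    have h1 : (ρ a - 1) * (ρ b - 1) - (ρ b - 1) * (ρ a - 1) = ρ a * ρ b - ρ b * ρ a := by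
      noncomm_ring
    rw [h1, sub_mul, ← map_mul, ← map_mul, ← map_mul, ← map_mul, commutatorElement_def,
      show b * a * (a⁻¹ * b⁻¹) = 1 by group, map_one, mul_assoc (a * b)]
  rw [e]
  calc _ ≤ ‖(ρ a - 1) * (ρ b - 1) - (ρ b - 1) * (ρ a - 1)‖ * 1 :=
        (norm_mul_le _ _).trans (by gcongr; exact norm_map_le_one hρ _)
    _ ≤ ‖ρ a - 1‖ * ‖ρ b - 1‖ + ‖ρ b - 1‖ * ‖ρ a - 1‖ := by
        rw [mul_one]
        exact (norm_sub_le _ _).trans (add_le_add (norm_mul_le _ _) (norm_mul_le _ _))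
    _ = _ := by ring

/-- If the commutator `D` of the isometries `A` and `B` commutes with `B`, then
`D ^ n = [A, B ^ n]` stays within `2 ‖A - 1‖` of the identity, so `D = 1` for small `A - 1`. -/
theorem map_commutator_eq_one
    (hρ : ∀ g v w, inner ℝ (ρ g v) (ρ g w) = inner ℝ v w) {a b : Γ}
    (ha : ‖ρ a - 1‖ < 1 / 2) (hab : Commute (ρ ⁅a, b⁆) (ρ b)) : ρ ⁅a, b⁆ = 1 := by
  have hpow : ∀ n : ℕ, ρ ⁅a, b⁆ ^ n = ρ ⁅a, b ^ n⁆ := by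
    intro n
    have h1 : ρ (a * b ^ n * a⁻¹) = ρ ⁅a, b⁆ ^ n * ρ b ^ n := by
      rw [← hab.mul_pow, ← map_mul, ← conj_pow, map_pow, commutatorElement_def]
      group
    have h2 : ρ (a * b ^ n * a⁻¹) * ρ (b ^ n)⁻¹ = ρ ⁅a, b ^ n⁆ := by
      rw [← map_mul, commutatorElement_def]
    rw [← h2, h1, mul_assoc, ← map_pow ρ b, ← map_mul, mul_inv_cancel, map_one, mul_one]
  refine eq_one_of_norm_pow_sub_one_le (c := 2 * ‖ρ a - 1‖) (by linarith) fun n => ?_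
  have e : ρ ⁅a, b ^ n⁆ - 1 =
      ((ρ a - 1) * ρ (b ^ n) - ρ (b ^ n) * (ρ a - 1)) * ρ (a⁻¹ * (b ^ n)⁻¹) := by
    have h1 : (ρ a - 1) * ρ (b ^ n) - ρ (b ^ n) * (ρ a - 1)
        = ρ a * ρ (b ^ n) - ρ (b ^ n) * ρ a := by
      noncomm_ring
    rw [h1, sub_mul, ← map_mul, ← map_mul, ← map_mul, ← map_mul, commutatorElement_def,
      show b ^ n * a * (a⁻¹ * (b ^ n)⁻¹) = 1 by group, map_one, mul_assoc (a * b ^ n)]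
  rw [hpow, e]
  have hb := norm_map_le_one hρ (b ^ n)
  calc _ ≤ ‖(ρ a - 1) * ρ (b ^ n) - ρ (b ^ n) * (ρ a - 1)‖ * 1 :=
        (norm_mul_le _ _).trans (by gcongr; exact norm_map_le_one hρ _)
    _ ≤ ‖ρ a - 1‖ * 1 + 1 * ‖ρ a - 1‖ := by
        rw [mul_one]
        refine (norm_sub_le _ _).trans (add_le_add ?_ ?_)
        · exact (norm_mul_le _ _).trans (by gcongr)
        · exact (norm_mul_le _ _).trans (by gcongr)
    _ = _ := by ring

section Cocycle

variable (hx : ∀ a b, x (a * b) = x a + ρ a (x b))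
include hx

theorem cocycle_one : x 1 = 0 := by
  have := hx 1 1
  rw [mul_one, map_one] at this
  simpa using this

theorem cocycle_inv (a : Γ) : x a⁻¹ = -ρ a⁻¹ (x a) := by
  have := hx a⁻¹ a
  rw [inv_mul_cancel, cocycle_one hx] at this
  exact eq_neg_of_add_eq_zero_left this.symm

theorem cocycle_commutator (a b : Γ) :
    x ⁅a, b⁆ = (x a - ρ (a * b * a⁻¹) (x a)) + ρ a (x b - ρ (b * a⁻¹ * b⁻¹) (x b)) := by
  rw [commutatorElement_def]
  simp only [hx, cocycle_inv hx, map_mul, mul_apply_eq_comp, map_neg, map_sub]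
  abel

theorem norm_cocycle_commutator_le
    (hρ : ∀ g v w, inner ℝ (ρ g v) (ρ g w) = inner ℝ v w) (a b : Γ) :
    ‖x ⁅a, b⁆‖ ≤ ‖ρ b - 1‖ * ‖x a‖ + ‖ρ a - 1‖ * ‖x b‖ := by
  have conj : ∀ (g h : Γ) (v : E), ‖v - ρ (g * h * g⁻¹) v‖ ≤ ‖ρ h - 1‖ * ‖v‖ := by
    intro g h v
    have e : v - ρ (g * h * g⁻¹) v = -ρ g ((ρ h - 1) (ρ g⁻¹ v)) := by
      simp only [map_mul, mul_apply_eq_comp, sub_apply,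
        one_apply_eq_self, map_sub, map_mul_inv_apply]
      abel
    rw [e, norm_neg, norm_map_eq hρ]
    exact ((ρ h - 1).le_opNorm _).trans_eq (by rw [norm_map_eq hρ])
  have hinv := norm_map_inv_sub_one_le hρ a
  rw [cocycle_commutator hx]
  refine (norm_add_le _ _).trans (add_le_add (conj a b _) ?_)
  rw [norm_map_eq hρ]
  exact (conj b a⁻¹ _).trans (by gcongr)

/-- Iterated commutators `[…[[a, b], b]…, b]` of elements with small rotational parts converge to
the identity, hence reach it by discreteness; so the rotational parts commute. -/
theorem commute_of_small
    (hρ : ∀ g v w, inner ℝ (ρ g v) (ρ g w) = inner ℝ v w)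
    (hfin : ∀ R : ℝ, {g : Γ | ‖x g‖ ≤ R}.Finite) {a b : Γ}
    (ha : ‖ρ a - 1‖ < 1 / 4) (hb : ‖ρ b - 1‖ < 1 / 4) : Commute (ρ a) (ρ b) := by
  obtain ⟨u, hu0, hus⟩ : ∃ u : ℕ → Γ, u 0 = a ∧ ∀ n, u (n + 1) = ⁅u n, b⁆ :=
    ⟨fun n => Nat.rec a (fun _ g => ⁅g, b⁆) n, rfl, fun _ => rfl⟩
  have hnorm : ∀ n, ‖ρ (u n) - 1‖ ≤ (1 / 4) * (1 / 2) ^ n := by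
    intro n
    induction n with
    | zero => rw [hu0]; simpa using ha.le
    | succ n ih =>
      rw [hus, pow_succ]
      have h0 : (0 : ℝ) < (1 / 2) ^ n := by positivity
      calc _ ≤ 2 * ‖ρ (u n) - 1‖ * ‖ρ b - 1‖ := norm_map_commutator_sub_one_le hρ _ _
        _ ≤ 2 * ((1 / 4) * (1 / 2) ^ n) * (1 / 4) := by gcongr
        _ = _ := by ring
  have hxn : ∀ n, ‖x (u n)‖ ≤ (‖x a‖ + ‖x b‖) * (1 / 2) ^ n := by
    intro n
    induction n with
    | zero => rw [hu0]; simp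
    | succ n ih =>
      rw [hus, pow_succ]
      have h0 : (0 : ℝ) < (1 / 2) ^ n := by positivity
      calc _ ≤ ‖ρ b - 1‖ * ‖x (u n)‖ + ‖ρ (u n) - 1‖ * ‖x b‖ :=
            norm_cocycle_commutator_le hx hρ _ _
        _ ≤ (1 / 4) * ((‖x a‖ + ‖x b‖) * (1 / 2) ^ n) +
            ((1 / 4) * (1 / 2) ^ n) * (‖x a‖ + ‖x b‖) := by
          gcongr
          · exact hnorm n
          · exact le_add_of_nonneg_left (norm_nonneg _)
        _ = _ := by ring
  have hrange : (Set.range fun n => ρ (u n)).Finite := by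
    refine ((hfin (‖x a‖ + ‖x b‖)).image ρ).subset ?_
    rintro _ ⟨n, rfl⟩
    refine ⟨u n, (hxn n).trans ?_, rfl⟩
    exact mul_le_of_le_one_right (by positivity) (pow_le_one₀ (by norm_num) (by norm_num))
  have hlim : Tendsto (fun n => ρ (u n)) atTop (𝓝 1) := by
    rw [tendsto_iff_norm_sub_tendsto_zero]
    refine squeeze_zero (fun _ => norm_nonneg _) hnorm ?_
    simpa using (tendsto_pow_atTop_nhds_zero_of_lt_one (r := (1 / 2 : ℝ)) (by norm_num)
      (by norm_num)).const_mul (1 / 4 : ℝ)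
  obtain ⟨n, hn⟩ := hrange.isClosed.mem_of_tendsto hlim
    (Eventually.of_forall Set.mem_range_self)
  have comm_of : ∀ g : Γ, ρ ⁅g, b⁆ = 1 → Commute (ρ g) (ρ b) := by
    intro g hg
    change ρ g * ρ b = ρ b * ρ g
    rw [← map_mul, ← map_mul, show g * b = ⁅g, b⁆ * (b * g) by
      rw [commutatorElement_def]; group, map_mul, hg, one_mul]
  have small : ∀ n, ‖ρ (u n) - 1‖ < 1 / 2 := fun n =>
    lt_of_le_of_lt ((hnorm n).trans (mul_le_of_le_one_right (by norm_num)
      (pow_le_one₀ (by norm_num) (by norm_num)))) (by norm_num)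
  have descend : ∀ n, ρ (u n) = 1 → ρ (u 1) = 1 := by
    intro n
    induction n with
    | zero =>
      intro h
      have := norm_map_commutator_sub_one_le hρ (u 0) b
      rw [h, sub_self, norm_zero, mul_zero, zero_mul, ← hus] at this
      exact sub_eq_zero.1 (norm_le_zero_iff.1 this)
    | succ n ih =>
      intro h
      rcases n with _ | n
      · exact h
      · refine ih ?_
        have hc := comm_of (u (n + 1)) (by rw [← hus, h])
        rw [hus] at hc ⊢
        exact map_commutator_eq_one hρ (small n) hc
  exact comm_of a (by rw [← hu0, ← hus]; exact descend n hn)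

/-- Translations in the group are fixed by all small rotational parts. -/
theorem map_eq_self_of_translation
    (hρ : ∀ g v w, inner ℝ (ρ g v) (ρ g w) = inner ℝ v w)
    (hfin : ∀ R : ℝ, {g : Γ | ‖x g‖ ≤ R}.Finite) {b t : Γ}
    (hb : ‖ρ b - 1‖ < 1 / 4) (ht : ρ t = 1) : ρ b (x t) = x t := by
  obtain ⟨u, hu0, hus⟩ : ∃ u : ℕ → Γ, u 0 = t ∧ ∀ n, u (n + 1) = ⁅b, u n⁆ :=
    ⟨fun n => Nat.rec t (fun _ g => ⁅b, g⁆) n, rfl, fun _ => rfl⟩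
  have hut : ∀ n, ρ (u n) = 1 := by
    intro n
    induction n with
    | zero => rwa [hu0]
    | succ n ih =>
      have := norm_map_commutator_sub_one_le hρ b (u n)
      rw [ih, sub_self, norm_zero, mul_zero, ← hus] at this
      exact sub_eq_zero.1 (norm_le_zero_iff.1 this)
  have hinv : ∀ n, ρ (u n)⁻¹ = 1 := fun n => by
    have h : ρ (u n) * ρ (u n)⁻¹ = 1 := by rw [← map_mul, mul_inv_cancel, map_one]
    rwa [hut, one_mul] at h
  have hxu : ∀ n, x (u (n + 1)) = (ρ b - 1) (x (u n)) := by
    intro n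
    rw [hus, cocycle_commutator hx]
    have hbb : ρ b * ρ b⁻¹ = 1 := by rw [← map_mul, mul_inv_cancel, map_one]
    have h1 : ρ (b * u n * b⁻¹) = 1 := by
      rw [map_mul, map_mul, hut, mul_one, hbb]
    have h2 : ρ b * ρ (u n * b⁻¹ * (u n)⁻¹) = 1 := by
      rw [map_mul, map_mul, hut, hinv, mul_one, one_mul, hbb]
    rw [map_sub, ← mul_apply_eq_comp, h2, h1]
    simp
  have hxn : ∀ n, ‖x (u n)‖ ≤ ‖x t‖ * (1 / 4) ^ n := by
    intro n
    induction n with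
    | zero => simp [hu0]
    | succ n ih =>
      rw [hxu, pow_succ]
      calc _ ≤ ‖ρ b - 1‖ * ‖x (u n)‖ := (ρ b - 1).le_opNorm _
        _ ≤ (1 / 4) * (‖x t‖ * (1 / 4) ^ n) := by gcongr
        _ = _ := by ring
  have hrange : (Set.range fun n => x (u n)).Finite := by
    refine ((hfin ‖x t‖).image x).subset ?_
    rintro _ ⟨n, rfl⟩
    refine ⟨u n, (hxn n).trans ?_, rfl⟩
    exact mul_le_of_le_one_right (by positivity) (pow_le_one₀ (by norm_num) (by norm_num))
  have hlim : Tendsto (fun n => x (u n)) atTop (𝓝 0) := by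
    rw [tendsto_zero_iff_norm_tendsto_zero]
    refine squeeze_zero (fun _ => norm_nonneg _) hxn ?_
    simpa using (tendsto_pow_atTop_nhds_zero_of_lt_one (r := (1 / 4 : ℝ)) (by norm_num)
      (by norm_num)).const_mul ‖x t‖
  obtain ⟨n, hn⟩ := hrange.isClosed.mem_of_tendsto hlim
    (Eventually.of_forall Set.mem_range_self)
  have descend : ∀ n, x (u n) = 0 → x (u 1) = 0 := by
    intro n
    induction n with
    | zero => intro h; rw [hxu 0, h, map_zero]
    | succ n ih =>
      intro h
      rcases n with _ | n
      · exact h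
      · refine ih ?_
        -- `ρ b - 1` is injective on its range because `ρ b` is an isometry
        rw [hxu] at h
        have h1 : ρ b (x (u (n + 1))) = x (u (n + 1)) := by simpa [sub_eq_zero] using h
        have h2 : inner ℝ (x (u (n + 1))) (x (u (n + 1))) = 0 := by
          nth_rewrite 1 [hxu]
          rw [sub_apply, inner_sub_left]
          rw [one_apply_eq_self, ← hρ b (x (u n)), h1, sub_self]
        exact inner_self_eq_zero.1 h2
  have h1 := descend n hn
  rw [hxu 0, hu0] at h1
  simpa [sub_eq_zero] using h1

end Cocycle

/-- An additive subgroup of a finite-dimensional space is cobounded in its linear span. -/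
theorem exists_bound_span_addSubgroup {F : Type*} [NormedAddCommGroup F] [NormedSpace ℝ F]
    [FiniteDimensional ℝ F] (Λ : AddSubgroup F) :
    ∃ R : ℝ, ∀ w ∈ Submodule.span ℝ (Λ : Set F), ∃ l ∈ Λ, ‖w - l‖ ≤ R := by
  obtain ⟨s, hs, hspan⟩ := (Submodule.fg_span_iff_fg_span_finset_subset (R := ℝ) (Λ : Set F)).1
    (IsNoetherian.noetherian _)
  refine ⟨∑ i ∈ s, ‖i‖, fun w hw => ?_⟩
  rw [hspan, Submodule.mem_span_finset] at hw
  obtain ⟨f, -, rfl⟩ := hw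
  refine ⟨∑ i ∈ s, ⌊f i⌋ • i, Λ.sum_mem fun i hi => Λ.zsmul_mem (hs hi) _, ?_⟩
  rw [← Finset.sum_sub_distrib]
  refine norm_sum_le_of_le _ fun i _ => ?_
  rw [← Int.cast_smul_eq_zsmul ℝ, ← sub_smul, norm_smul]
  refine mul_le_of_le_one_left (norm_nonneg _) ?_
  rw [Real.norm_eq_abs, Int.self_sub_floor, Int.abs_fract]
  exact (Int.fract_lt_one _).le

/-- The orbit of the origin under a discrete group of isometries of a Euclidean space lies at
bounded Hausdorff distance from a linear subspace. The group acts through a homomorphism to affine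
isometries with linear part `ρ` and translation part `x`. -/
theorem exists_submodule_near_orbit [FiniteDimensional ℝ E]
    (hρ : ∀ g v w, inner ℝ (ρ g v) (ρ g w) = inner ℝ v w)
    (hx : ∀ a b, x (a * b) = x a + ρ a (x b))
    (hfin : ∀ R : ℝ, {g : Γ | ‖x g‖ ≤ R}.Finite) :
    ∃ (W : Submodule ℝ E) (R : ℝ), (∀ g, ∃ w ∈ W, ‖x g - w‖ ≤ R) ∧
      ∀ w ∈ W, ∃ g, ‖x g - w‖ ≤ R := by
  -- `1 / 4` makes commutators contract both rotational and translation parts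
  let S : Set Γ := {g | ‖ρ g - 1‖ < 1 / 4}
  let F : Submodule ℝ E := ⨅ b ∈ S, LinearMap.ker (ρ b - 1 : E →L[ℝ] E).toLinearMap
  have hF : ∀ v, v ∈ F ↔ ∀ b ∈ S, ρ b v = v := by
    intro v
    simp [F, Submodule.mem_iInf, sub_eq_zero]
  let P : E →L[ℝ] E := F.starProjection
  have hPρ : ∀ b ∈ S, ∀ v, P (ρ b v) = P v := by
    intro b hb v
    refine Submodule.eq_starProjection_of_mem_of_inner_eq_zero (K := F)
      (Submodule.starProjection_apply_mem _ _) fun f hf => ?_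
    have h1 := Submodule.sub_starProjection_mem_orthogonal (K := F) v
    have h2 : inner ℝ (v - F.starProjection v) f = 0 := by
      rw [real_inner_comm]; exact h1 f hf
    rw [inner_sub_left] at h2 ⊢
    rw [← h2, ← hρ b v f, (hF f).1 hf b hb, sub_left_inj]
  have hPx : ∀ a ∈ S, ∀ g, P (x (a * g)) = P (x a) + P (x g) := by
    intro a ha g
    rw [hx, map_add, hPρ a ha]
  have hSinv : ∀ a ∈ S, a⁻¹ ∈ S := fun a ha =>
    lt_of_le_of_lt (norm_map_inv_sub_one_le hρ a) ha
  -- commutators of elements of `S` are translations by vectors of `F` orthogonal to `F`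
  have hcomm : ∀ a ∈ S, ∀ b ∈ S, (ρ b - 1) (x a) = (ρ a - 1) (x b) := by
    intro a ha b hb
    have hc : ρ a * ρ b = ρ b * ρ a := commute_of_small hx hρ hfin ha hb
    have hρ1 : ρ ⁅a, b⁆ = 1 := by
      rw [commutatorElement_def, map_mul, map_mul, map_mul, hc, ← map_mul, ← map_mul, ← map_mul,
        show b * a * a⁻¹ * b⁻¹ = 1 by group, map_one]
    have hmem : x ⁅a, b⁆ ∈ F := (hF _).2 fun c hc =>
      map_eq_self_of_translation hx hρ hfin hc hρ1
    have hP0 : P (x ⁅a, b⁆) = 0 := by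
      rw [commutatorElement_def, mul_assoc, mul_assoc, hPx a ha, hPx b hb, hPx _ (hSinv a ha)]
      have hi : ∀ c ∈ S, P (x c⁻¹) = -P (x c) := fun c hc => by
        rw [cocycle_inv hx, map_neg, hPρ _ (hSinv c hc)]
      rw [hi a ha, hi b hb]; abel
    have hx0 : x ⁅a, b⁆ = 0 := by
      rw [← hP0]; exact (Submodule.starProjection_eq_self_iff.2 hmem).symm
    have h1 : x (a * b) = x (b * a) := by
      have : a * b = ⁅a, b⁆ * (b * a) := by rw [commutatorElement_def]; group
      rw [this, hx, hx0, hρ1, zero_add]; rfl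
    rw [hx, hx] at h1
    simp only [sub_apply, one_apply_eq_self]
    rw [sub_eq_sub_iff_add_eq_add, add_comm, ← h1, add_comm]
  -- the components orthogonal to `F` are bounded on `S`
  obtain ⟨R₁, hR₁⟩ : ∃ R, ∀ a ∈ S, ‖x a - P (x a)‖ ≤ R := by
    obtain ⟨s, hs, hspan⟩ := (Submodule.fg_span_iff_fg_span_finset_subset (R := ℝ)
      ((fun b => ρ b - 1) '' S)).1 (IsNoetherian.noetherian _)
    have hs' : ∀ i : s, ∃ b ∈ S, ρ b - 1 = (i : E →L[ℝ] E) := fun i => hs i.2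
    choose β hβS hβ using hs'
    let Φ : Fᗮ →ₗ[ℝ] (s → E) :=
      LinearMap.pi fun i => (i : E →L[ℝ] E).toLinearMap ∘ₗ Fᗮ.subtype
    have hker : LinearMap.ker Φ = ⊥ := by
      rw [LinearMap.ker_eq_bot']
      intro v hv
      have h0 : ∀ T ∈ Submodule.span ℝ ((fun b => ρ b - 1) '' S), T (v : E) = 0 := by
        rw [hspan]
        intro T hT
        induction hT using Submodule.span_induction with
        | mem T hT => exact congrFun hv ⟨T, hT⟩
        | zero => rfl
        | add T U _ _ h1 h2 => rw [add_apply, h1, h2, add_zero]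
        | smul c T _ h1 => rw [smul_apply, h1, smul_zero]
      have hvF : (v : E) ∈ F := (hF _).2 fun b hb => by
        have := h0 (ρ b - 1) (Submodule.subset_span ⟨b, hb, rfl⟩)
        simpa [sub_eq_zero] using this
      have := v.2 _ hvF
      exact Subtype.ext (inner_self_eq_zero.1 this)
    obtain ⟨K, -, hK⟩ := Φ.exists_antilipschitzWith hker
    refine ⟨K * ∑ i : s, 2 * ‖x (β i)‖, fun a ha => ?_⟩
    let v : Fᗮ := ⟨x a - P (x a), Submodule.sub_starProjection_mem_orthogonal _⟩
    have h1 : ‖v‖ ≤ K * ‖Φ v‖ := by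
      have := hK.le_mul_dist v 0
      simpa using this
    refine h1.trans (mul_le_mul_of_nonneg_left ?_ K.2)
    refine (pi_norm_le_iff_of_nonneg (Finset.sum_nonneg fun i _ => by positivity)).2 fun i => ?_
    have h2 : Φ v i = (ρ a - 1) (x (β i)) := by
      change (i : E →L[ℝ] E) (x a - P (x a)) = _
      rw [← hcomm a ha _ (hβS i), ← hβ i, map_sub, sub_eq_self]
      have : P (x a) ∈ F := Submodule.starProjection_apply_mem _ _
      simpa [sub_eq_zero] using (hF _).1 this _ (hβS i)
    rw [h2]
    refine le_trans ?_ (Finset.single_le_sum (f := fun i : s => 2 * ‖x (β i)‖)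
      (fun i _ => by positivity) (Finset.mem_univ i))
    refine ((ρ a - 1).le_opNorm _).trans ?_
    gcongr
    exact (le_of_lt ha).trans (by norm_num)
  -- `Γ` is covered by finitely many cosets `S g`
  obtain ⟨t, ht⟩ : ∃ t : Finset Γ, ∀ g, ∃ h ∈ t, g * h⁻¹ ∈ S := by
    have htb : TotallyBounded (Set.range ρ) := by
      refine ((ProperSpace.isCompact_closedBall (0 : E →L[ℝ] E) 1).totallyBounded).subset ?_
      rintro _ ⟨g, rfl⟩
      simpa using norm_map_le_one hρ g
    obtain ⟨t, hts, htf, htc⟩ := Metric.finite_approx_of_totallyBounded htb (1 / 4) (by norm_num)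
    choose! r hr using fun y (hy : y ∈ t) => hts hy
    classical
    refine ⟨htf.toFinset.image r, fun g => ?_⟩
    have hg := htc (Set.mem_range_self g)
    simp only [Set.mem_iUnion, Metric.mem_ball] at hg
    obtain ⟨y, hy, hd⟩ := hg
    refine ⟨r y, Finset.mem_image_of_mem _ (htf.mem_toFinset.2 hy), ?_⟩
    have e : ρ (g * (r y)⁻¹) - 1 = (ρ g - ρ (r y)) * ρ (r y)⁻¹ := by
      rw [sub_mul, ← map_mul, ← map_mul, mul_inv_cancel, map_one]
    change ‖ρ (g * (r y)⁻¹) - 1‖ < 1 / 4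
    rw [e]
    refine lt_of_le_of_lt ((norm_mul_le _ _).trans
      (mul_le_of_le_one_right (norm_nonneg _) (norm_map_le_one hρ _))) ?_
    rwa [hr y hy, ← dist_eq_norm]
  have hdecomp : ∀ g, ∃ a ∈ S, ∃ h ∈ t, g = a * h := fun g => by
    obtain ⟨h, hh, hS⟩ := ht g
    exact ⟨_, hS, h, hh, by group⟩
  have hsum : ∀ h ∈ t, ‖x h‖ ≤ ∑ h ∈ t, ‖x h‖ := fun h hh =>
    Finset.single_le_sum (f := fun h => ‖x h‖) (fun _ _ => norm_nonneg _) hh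
  set Q := ∑ h ∈ t, ‖x h‖ with hQ
  have hnear : ∀ g, ‖x g - P (x g)‖ ≤ R₁ + (Q + ‖P‖ * Q) := by
    intro g
    obtain ⟨a, ha, h, hh, rfl⟩ := hdecomp g
    rw [hPx a ha, hx, show x a + ρ a (x h) - (P (x a) + P (x h)) =
      (x a - P (x a)) + (ρ a (x h) - P (x h)) by abel]
    refine (norm_add_le _ _).trans (add_le_add (hR₁ a ha) ((norm_sub_le _ _).trans
      (add_le_add ?_ ?_)))
    · rw [norm_map_eq hρ]; exact hsum h hh
    · exact (P.le_opNorm _).trans (by gcongr; exact hsum h hh)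
  let Γ' : Subgroup Γ := Subgroup.closure S
  have hadd : ∀ a ∈ Γ', ∀ g, P (x (a * g)) = P (x a) + P (x g) := by
    intro a ha
    induction ha using Subgroup.closure_induction with
    | mem a ha => exact hPx a ha
    | one => intro g; rw [one_mul, cocycle_one hx, map_zero, zero_add]
    | mul a b _ _ h1 h2 => intro g; rw [mul_assoc, h1, h2, h1, add_assoc]
    | inv a _ h =>
      intro g
      have h1 := h (a⁻¹ * g)
      have h2 := h a⁻¹
      rw [mul_inv_cancel_left] at h1
      rw [mul_inv_cancel, cocycle_one hx, map_zero] at h2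
      rw [h1, ← add_assoc, add_comm (P (x a⁻¹)), ← h2, zero_add]
  let Λ : AddSubgroup E :=
    { carrier := {v | ∃ a ∈ Γ', P (x a) = v}
      zero_mem' := ⟨1, Γ'.one_mem, by rw [cocycle_one hx, map_zero]⟩
      add_mem' := by
        rintro _ _ ⟨a, ha, rfl⟩ ⟨b, hb, rfl⟩
        exact ⟨a * b, Γ'.mul_mem ha hb, hadd a ha b⟩
      neg_mem' := by
        rintro _ ⟨a, ha, rfl⟩
        refine ⟨a⁻¹, Γ'.inv_mem ha, eq_neg_of_add_eq_zero_right ?_⟩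
        rw [← hadd a ha, mul_inv_cancel, cocycle_one hx, map_zero] }
  obtain ⟨R₂, hR₂⟩ := exists_bound_span_addSubgroup Λ
  refine ⟨Submodule.span ℝ (Λ : Set E), max (R₁ + Q) (R₁ + (Q + ‖P‖ * Q) + R₂),
    fun g => ?_, fun w hw => ?_⟩
  · obtain ⟨a, ha, h, hh, rfl⟩ := hdecomp g
    refine ⟨P (x a), Submodule.subset_span ⟨a, Subgroup.subset_closure ha, rfl⟩,
      le_trans ?_ (le_max_left _ _)⟩
    rw [hx, add_sub_right_comm]
    refine (norm_add_le _ _).trans (add_le_add (hR₁ a ha) ?_)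
    rw [norm_map_eq hρ]; exact hsum h hh
  · obtain ⟨_, ⟨a, -, rfl⟩, hl⟩ := hR₂ w hw
    refine ⟨a, le_trans ?_ (le_max_right _ _)⟩
    rw [← sub_add_sub_cancel _ (P (x a))]
    refine (norm_add_le _ _).trans (add_le_add (hnear a) ?_)
    rwa [norm_sub_rev]

end DiscreteIsometry

/-! ### Topology and metric geometry of the motion group -/

namespace CartanMotion

open Filter Topology

variable {V : Type*} [NormedAddCommGroup V] [InnerProductSpace ℝ V] [FiniteDimensional ℝ V]
  {G : Subgroup (V →L[ℝ] V)ˣ}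

theorem star_coe_cartanK (k : cartanK G) :
    star ((k : (V →L[ℝ] V)ˣ) : V →L[ℝ] V) = ((k⁻¹ : (V →L[ℝ] V)ˣ) : V →L[ℝ] V) := by
  have h : (star (k : (V →L[ℝ] V)ˣ))⁻¹ = k := k.2.2
  have h1 : star (k : (V →L[ℝ] V)ˣ) = (k : (V →L[ℝ] V)ˣ)⁻¹ := by rw [← h, inv_inv, h]
  rw [← h1]; rfl

theorem coe_cartanK_mem_unitary (k : cartanK G) :
    ((k : (V →L[ℝ] V)ˣ) : V →L[ℝ] V) ∈ unitary (V →L[ℝ] V) := by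
  rw [Unitary.mem_iff, star_coe_cartanK]
  simp

/-- A member of `G` that is unitary lies in `K`. -/
theorem mem_cartanK_of_mem_unitary {g : (V →L[ℝ] V)ˣ} (hg : g ∈ G)
    (hu : (g : V →L[ℝ] V) ∈ unitary (V →L[ℝ] V)) : g ∈ cartanK G := by
  refine ⟨hg, ?_⟩
  change (star g)⁻¹ = g
  rw [inv_eq_iff_mul_eq_one]
  exact Units.ext (Unitary.mem_iff.1 hu).1

theorem compactSpace_cartanK (hG : IsClosed (G : Set (V →L[ℝ] V)ˣ)) :
    CompactSpace (cartanK G) := by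
  have hU : IsCompact (unitary (V →L[ℝ] V) : Set (V →L[ℝ] V)) := by
    refine Metric.isCompact_of_isClosed_isBounded isClosed_unitary
      ((Metric.isBounded_closedBall (x := 0) (r := 1)).subset fun u hu => ?_)
    rw [mem_closedBall_zero_iff]
    rcases subsingleton_or_nontrivial V with h | h
    · have : u = 0 := Subsingleton.elim _ _
      simp [this]
    · exact (CStarRing.norm_of_mem_unitary hu).le
  have : CompactSpace (unitary (V →L[ℝ] V)) := isCompact_iff_compactSpace.1 hU
  have hc : Continuous (Unitary.toUnits : unitary (V →L[ℝ] V) → (V →L[ℝ] V)ˣ) :=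
    Units.continuous_iff.2 ⟨continuous_subtype_val,
      (continuous_star.comp continuous_subtype_val)⟩
  refine isCompact_iff_compactSpace.1 (?_ : IsCompact (cartanK G : Set (V →L[ℝ] V)ˣ))
  have himage : (cartanK G : Set (V →L[ℝ] V)ˣ) =
      Unitary.toUnits '' (Unitary.toUnits ⁻¹' (G : Set (V →L[ℝ] V)ˣ)) := by
    ext g
    constructor
    · intro hg
      refine ⟨⟨g, coe_cartanK_mem_unitary ⟨g, hg⟩⟩, ?_, Units.ext rfl⟩
      have : Unitary.toUnits (⟨g, coe_cartanK_mem_unitary ⟨g, hg⟩⟩ : unitary (V →L[ℝ] V)) = g :=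
        Units.ext rfl
      rw [Set.mem_preimage, this]
      exact hg.1
    · rintro ⟨u, hu, rfl⟩
      exact mem_cartanK_of_mem_unitary hu u.2
  have := ((hG.preimage hc).isCompact).image hc
  rwa [← himage] at this

theorem Ad_coe (k : cartanK G) (X : cartanP G) :
    (Ad G k X : V →L[ℝ] V) = ((k : (V →L[ℝ] V)ˣ) : V →L[ℝ] V) * (X : V →L[ℝ] V) *
      ((k⁻¹ : (V →L[ℝ] V)ˣ) : V →L[ℝ] V) := rfl

@[simp] theorem norm_Ad (k : cartanK G) (X : cartanP G) : ‖Ad G k X‖ = ‖X‖ := by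
  change ‖(Ad G k X : V →L[ℝ] V)‖ = ‖(X : V →L[ℝ] V)‖
  rw [Ad_coe, ← star_coe_cartanK,
    CStarRing.norm_mul_mem_unitary _ (Unitary.star_mem (coe_cartanK_mem_unitary k)),
    CStarRing.norm_mem_unitary_mul _ (coe_cartanK_mem_unitary k)]

theorem norm_smul_cartanP (c : ℝ) (X : cartanP G) : ‖c • X‖ = |c| * ‖X‖ :=
  norm_smul c (X : V →L[ℝ] V)

@[simp] theorem Ad_inv_Ad (k : cartanK G) (X : cartanP G) : Ad G k⁻¹ (Ad G k X) = X := by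
  rw [← Module.End.mul_apply, ← map_mul, inv_mul_cancel, map_one, Module.End.one_apply]

theorem Ad_mul_apply (k l : cartanK G) (X : cartanP G) :
    Ad G (k * l) X = Ad G k (Ad G l X) := by
  rw [map_mul, Module.End.mul_apply]

theorem cartanP_isSelfAdjoint (X : cartanP G) : star (X : V →L[ℝ] V) = X := neg_inj.1 X.2.2

namespace MotionGroup

/-- As a topological space, `G_θ` is `K × 𝔭`. -/
def homeo (G : Subgroup (V →L[ℝ] V)ˣ) : MotionGroup G ≃ₜ cartanK G × cartanP G where
  toFun a := (a.k, a.X)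
  invFun q := ⟨q.1, q.2⟩
  left_inv _ := rfl
  right_inv _ := rfl
  continuous_toFun := continuous_pair
  continuous_invFun := continuous_induced_rng.2 continuous_id

theorem continuous_X : Continuous fun a : MotionGroup G => a.X := continuous_pair.snd

theorem continuous_mk {T : Type*} [TopologicalSpace T] {f : T → cartanK G} {g : T → cartanP G}
    (hf : Continuous f) (hg : Continuous g) : Continuous fun t => (⟨f t, g t⟩ : MotionGroup G) :=
  (homeo G).symm.continuous.comp (hf.prodMk hg)

theorem continuous_ofP : Continuous (ofP : cartanP G → MotionGroup G) :=
  continuous_mk continuous_const continuous_id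

instance : T2Space (MotionGroup G) := (homeo G).isEmbedding.t2Space

@[simp] theorem ofP_k (X : cartanP G) : (ofP X).k = 1 := rfl

@[simp] theorem ofP_X (X : cartanP G) : (ofP X).X = X := rfl

theorem ofP_add (X Y : cartanP G) : ofP (X + Y) = ofP X * ofP Y := by
  ext1 <;> simp

theorem ofP_neg (X : cartanP G) : ofP (-X) = (ofP X)⁻¹ := by
  ext1 <;> simp

theorem isCompact_norm_le (hG : IsClosed (G : Set (V →L[ℝ] V)ˣ)) (R : ℝ) :
    IsCompact {a : MotionGroup G | ‖a.X‖ ≤ R} := by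
  have := compactSpace_cartanK hG
  have h : {a : MotionGroup G | ‖a.X‖ ≤ R} =
      homeo G ⁻¹' (Set.univ ×ˢ Metric.closedBall (0 : cartanP G) R) := by
    ext a
    simp [homeo]
  rw [h, (homeo G).isCompact_preimage]
  exact isCompact_univ.prod (isCompact_closedBall _ _)

theorem isOpen_norm_lt (R : ℝ) : IsOpen {a : MotionGroup G | ‖a.X‖ < R} :=
  isOpen_lt continuous_X.norm continuous_const

/-- A discrete subgroup of `G_θ` meets each bounded set in a finite set. -/
theorem finite_norm_le_of_discrete (hG : IsClosed (G : Set (V →L[ℝ] V)ˣ))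
    (Γ : Subgroup (MotionGroup G)) [DiscreteTopology Γ] (R : ℝ) :
    {g : Γ | ‖(g : MotionGroup G).X‖ ≤ R}.Finite := by
  have hcl : IsClosed (Γ : Set (MotionGroup G)) := Subgroup.isClosed_of_discrete
  have hc : IsCompact {g : Γ | ‖(g : MotionGroup G).X‖ ≤ R} :=
    hcl.isClosedEmbedding_subtypeVal.isCompact_preimage (isCompact_norm_le hG R)
  exact hc.finite_of_discrete

end MotionGroup

end CartanMotion

/-! ### Closed subgroups of a vector space -/

open Filter Topology in
/-- A closed additive subgroup that contains no line of the subspace `C` has no small nonzero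
elements in `C`: integer multiples of small elements would accumulate along a line. -/
theorem AddSubgroup.exists_pos_forall_norm_lt_eq_zero {E : Type*} [NormedAddCommGroup E]
    [NormedSpace ℝ E] [FiniteDimensional ℝ E] {A : AddSubgroup E} (hA : IsClosed (A : Set E))
    {C : Submodule ℝ E} (hC : ∀ u ∈ C, (∀ t : ℝ, t • u ∈ A) → u = 0) :
    ∃ ε > 0, ∀ c ∈ A, c ∈ C → ‖c‖ < ε → c = 0 := by
  by_contra! hcon
  have hcon' : ∀ n : ℕ, ∃ c ∈ A, c ∈ C ∧ ‖c‖ < 1 / ((n : ℝ) + 1) ∧ c ≠ 0 := fun n =>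
    hcon _ (by positivity)
  choose c hcA hcC hcn hc0 using hcon'
  have hpos : ∀ n, 0 < ‖c n‖ := fun n => norm_pos_iff.2 (hc0 n)
  have hlim : Tendsto (fun n => ‖c n‖) atTop (𝓝 0) :=
    squeeze_zero (fun _ => norm_nonneg _) (fun n => (hcn n).le)
      tendsto_one_div_add_atTop_nhds_zero_nat
  obtain ⟨u, hu, φ, hφ, hlimu⟩ := (isCompact_sphere (0 : E) 1).tendsto_subseq
    (x := fun n => ‖c n‖⁻¹ • c n) (fun n => by
      rw [mem_sphere_zero_iff_norm, norm_smul, norm_inv, norm_norm,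
        inv_mul_cancel₀ (hpos n).ne'])
  have huC : u ∈ C := C.closed_of_finiteDimensional.mem_of_tendsto hlimu
    (Eventually.of_forall fun n => C.smul_mem _ (hcC _))
  have hline : ∀ t : ℝ, t • u ∈ A := by
    intro t
    have hs : Tendsto (fun n => (⌊t / ‖c (φ n)‖⌋ : ℝ) * ‖c (φ n)‖) atTop (𝓝 t) := by
      rw [tendsto_iff_norm_sub_tendsto_zero]
      refine squeeze_zero (fun _ => norm_nonneg _) (fun n => ?_) (hlim.comp hφ.tendsto_atTop)
      have hp := hpos (φ n)
      have e : (⌊t / ‖c (φ n)‖⌋ : ℝ) * ‖c (φ n)‖ - t =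
          -(Int.fract (t / ‖c (φ n)‖) * ‖c (φ n)‖) := by
        rw [← Int.self_sub_floor, sub_mul, div_mul_cancel₀ _ hp.ne']; ring
      rw [e, norm_neg, Real.norm_eq_abs, abs_of_nonneg (mul_nonneg (Int.fract_nonneg _) hp.le)]
      exact mul_le_of_le_one_left hp.le (Int.fract_lt_one _).le
    refine hA.mem_of_tendsto (hs.smul hlimu) (Eventually.of_forall fun n => ?_)
    have e : ((⌊t / ‖c (φ n)‖⌋ : ℝ) * ‖c (φ n)‖) • (‖c (φ n)‖⁻¹ • c (φ n)) =
        ⌊t / ‖c (φ n)‖⌋ • c (φ n) := by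
      rw [smul_smul, mul_assoc, mul_inv_cancel₀ (hpos _).ne', mul_one, Int.cast_smul_eq_zsmul]
    simp only [Function.comp_apply, e]
    exact A.zsmul_mem (hcA _) _
  have := hC u huC hline
  rw [mem_sphere_zero_iff_norm, this, norm_zero] at hu
  exact zero_ne_one hu

/-- The identity component of a closed additive subgroup is a linear subspace. -/
theorem AddSubgroup.smul_mem_of_isPreconnected {E : Type*} [NormedAddCommGroup E]
    [NormedSpace ℝ E] [FiniteDimensional ℝ E] {A : AddSubgroup E} (hA : IsClosed (A : Set E))
    {S : Set E} (hS : IsPreconnected S) (hSA : S ⊆ A) (h0 : 0 ∈ S) {y : E} (hy : y ∈ S) (t : ℝ) :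
    t • y ∈ A := by
  let L : Submodule ℝ E :=
    { carrier := {v | ∀ t : ℝ, t • v ∈ A}
      zero_mem' := fun t => by rw [smul_zero]; exact A.zero_mem
      add_mem' := fun hv hw t => by rw [smul_add]; exact A.add_mem (hv t) (hw t)
      smul_mem' := fun c v hv t => by rw [smul_smul]; exact hv _ }
  obtain ⟨C, hC⟩ := L.exists_isCompl
  obtain ⟨ε, hε, hsmall⟩ := AddSubgroup.exists_pos_forall_norm_lt_eq_zero hA (C := C)
    fun u hu hline => by
      have : u ∈ L ⊓ C := ⟨hline, hu⟩
      rwa [hC.inf_eq_bot, Submodule.mem_bot] at this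
  let π : E →ₗ[ℝ] E := C.subtype ∘ₗ C.projectionOnto L hC.symm
  have hπC : ∀ v, π v ∈ C := fun v => (C.projectionOnto L hC.symm v).2
  have hπL : ∀ v, v - π v ∈ L := fun v => by
    rw [← Submodule.ker_projectionOnto hC.symm, LinearMap.mem_ker, map_sub, sub_eq_zero]
    exact (Submodule.projectionOnto_apply_left hC.symm _).symm
  have hLA : ∀ v ∈ L, v ∈ A := fun v hv => by simpa using hv 1
  have hπA : ∀ v ∈ A, π v ∈ A := fun v hv => by
    have := A.sub_mem hv (hLA _ (hπL v))
    rwa [sub_sub_cancel] at this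
  have hT : IsPreconnected (π '' S) := hS.image _ π.continuous_of_finiteDimensional.continuousOn
  have hTmem : ∀ c ∈ π '' S, ‖c‖ < ε → c = 0 := by
    rintro _ ⟨v, hv, rfl⟩ h
    exact hsmall _ (hπA v (hSA hv)) (hπC v) h
  have hπy : π y = 0 := by
    by_contra hne
    obtain ⟨c, hc, h1, h2⟩ := hT {v | ‖v‖ < ε} {v | ε / 2 < ‖v‖}
      (isOpen_lt continuous_norm continuous_const) (isOpen_lt continuous_const continuous_norm)
      (fun v _ => (lt_or_ge ‖v‖ ε).imp id fun h => lt_of_lt_of_le (half_lt_self hε) h)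
      ⟨0, ⟨0, h0, map_zero π⟩, by simpa using hε⟩
      ⟨π y, ⟨y, hy, rfl⟩, lt_of_lt_of_le (half_lt_self hε)
        (not_lt.1 fun h => hne (hTmem _ ⟨y, hy, rfl⟩ h))⟩
    rw [Set.mem_ofPred_eq, hTmem c hc h1, norm_zero] at h2
    linarith
  have := hπL y
  rw [hπy, sub_zero] at this
  exact this t

namespace CartanMotion.MotionGroup

open Filter Topology

variable {V : Type*} [NormedAddCommGroup V] [InnerProductSpace ℝ V] [FiniteDimensional ℝ V]
  {G : Subgroup (V →L[ℝ] V)ˣ}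

/-! ### Structure of stable subgroups -/

/-- `H` is the semidirect product of its rotational part `H ∩ K` and the linear subspace `P`
of `𝔭`. -/
def IsSplit (H : Subgroup (MotionGroup G)) (P : Submodule ℝ (cartanP G)) : Prop :=
  ∀ a : MotionGroup G, a ∈ H ↔ (⟨a.k, 0⟩ : MotionGroup G) ∈ H ∧ a.X ∈ P

theorem isSplit_top : IsSplit (⊤ : Subgroup (MotionGroup G)) ⊤ := fun _ => by simp

/-- A `thetaBar`-stable subgroup contains `(1, 2X)` along with `(k, X)`. A lattice direction in
`H ∩ 𝔭` would produce infinitely many components, so `H ∩ 𝔭` is a linear subspace. -/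
theorem exists_isSplit {H : Subgroup (MotionGroup G)} (hcl : IsClosed (H : Set (MotionGroup G)))
    (hcomp : Finite (ConnectedComponents H)) (hst : ∀ h ∈ H, thetaBar h ∈ H) :
    ∃ P, IsSplit H P := by
  let A : AddSubgroup (cartanP G) :=
    { carrier := {X | ofP X ∈ H}
      zero_mem' := H.one_mem
      add_mem' := fun {X Y} hX hY => by
        rw [Set.mem_ofPred_eq, ofP_add]; exact H.mul_mem hX hY
      neg_mem' := fun {X} hX => by
        rw [Set.mem_ofPred_eq, ofP_neg]; exact H.inv_mem hX }
  let A' : AddSubgroup (cartanP G) := A.comap (zsmulAddGroupHom 2)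
  have hA' : ∀ X, X ∈ A' ↔ ofP (X + X) ∈ H := fun X => by
    change ofP ((2 : ℤ) • X) ∈ H ↔ _
    rw [two_zsmul]
  have hA'cl : IsClosed (A' : Set (cartanP G)) := by
    have : (A' : Set (cartanP G)) = (fun X => ofP (X + X)) ⁻¹' (H : Set (MotionGroup G)) := by
      ext X; exact hA' X
    rw [this]
    exact hcl.preimage (continuous_ofP.comp (continuous_id.add continuous_id))
  have hAA' : ∀ X ∈ A, X ∈ A' := fun X hX => A.zsmul_mem hX 2
  have hX2 : ∀ a ∈ H, a.X ∈ A' := by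
    intro a ha
    rw [hA']
    have : ofP (a.X + a.X) = a * (thetaBar a)⁻¹ := by
      ext1
      · simp [thetaBar]
      · simp [thetaBar]
    rw [this]
    exact H.mul_mem ha (H.inv_mem (hst a ha))
  have hline : ∀ X ∈ A, ∀ t : ℝ, t • X ∈ A' := by
    intro X hX t
    have hmem : ∀ n : ℕ, ofP (n • X) ∈ H := fun n => A.nsmul_mem hX n
    obtain ⟨m, n, hmn, heq⟩ := Finite.exists_ne_map_eq_of_infinite
      fun n : ℕ => (ConnectedComponents.mk (⟨ofP (n • X), hmem n⟩ : H))
    have hcc := ConnectedComponents.coe_eq_coe.1 heq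
    let S : Set (cartanP G) := (fun a : H => (a : MotionGroup G).X - m • X) ''
      connectedComponent (⟨ofP (m • X), hmem m⟩ : H)
    have hS : IsPreconnected S := isPreconnected_connectedComponent.image _
      ((continuous_X.comp continuous_subtype_val).sub continuous_const).continuousOn
    have hSA : S ⊆ A' := by
      rintro _ ⟨a, -, rfl⟩
      exact A'.sub_mem (hX2 a a.2) (hAA' _ (A.nsmul_mem hX m))
    have h0 : (0 : cartanP G) ∈ S := ⟨_, mem_connectedComponent, by simp⟩
    have hn : n • X - m • X ∈ S := ⟨⟨ofP (n • X), hmem n⟩, by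
      rw [hcc]; exact mem_connectedComponent, by simp⟩
    have key := AddSubgroup.smul_mem_of_isPreconnected hA'cl hS hSA h0 hn
    have hd : ((n : ℝ) - m) ≠ 0 := sub_ne_zero.2 fun h => hmn (Nat.cast_injective h).symm
    have e : t • X = (t / ((n : ℝ) - m)) • (n • X - m • X) := by
      rw [← Nat.cast_smul_eq_nsmul ℝ, ← Nat.cast_smul_eq_nsmul ℝ, ← sub_smul, smul_smul,
        div_mul_cancel₀ _ hd]
    rw [e]
    exact key _
  let P : Submodule ℝ (cartanP G) :=
    { A with
      smul_mem' := fun c X hX => by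
        have := (hA' _).1 (hline X hX (c / 2))
        rw [← add_smul, add_halves] at this
        exact this }
  have hP : ∀ X, X ∈ P ↔ ofP X ∈ H := fun X => Iff.rfl
  refine ⟨P, fun a => ?_⟩
  have hdec : a = ofP a.X * ⟨a.k, 0⟩ := by ext1 <;> simp
  constructor
  · intro ha
    have h2 : a.X ∈ P := by
      have h := (hA' _).1 (hX2 a ha)
      have e : a.X = (1 / 2 : ℝ) • (a.X + a.X) := by
        rw [← two_smul ℝ, smul_smul]; norm_num
      rw [e]
      exact P.smul_mem _ h
    refine ⟨?_, h2⟩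
    have : (⟨a.k, 0⟩ : MotionGroup G) = (ofP a.X)⁻¹ * a := by rw [eq_inv_mul_iff_mul_eq, ← hdec]
    rw [this]
    exact H.mul_mem (H.inv_mem h2) ha
  · rintro ⟨h1, h2⟩
    rw [hdec]
    exact H.mul_mem h2 h1

namespace IsSplit

variable {H : Subgroup (MotionGroup G)} {P : Submodule ℝ (cartanP G)}

theorem ofP_mem_iff (h : IsSplit H P) {X : cartanP G} : ofP X ∈ H ↔ X ∈ P :=
  (h _).trans (and_iff_right H.one_mem)

theorem Ad_mem (h : IsSplit H P) {a : MotionGroup G} (ha : a ∈ H) {X : cartanP G} (hX : X ∈ P) :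
    Ad G a.k X ∈ P := by
  have h1 : (⟨a.k, 0⟩ : MotionGroup G) * ofP X ∈ H :=
    H.mul_mem ((h a).1 ha).1 (h.ofP_mem_iff.2 hX)
  simpa using ((h _).1 h1).2

end IsSplit

end CartanMotion.MotionGroup

/-! ### Non-compact dimension -/

/-- The velocity of a curve in a linear subspace lies in the subspace. -/
theorem HasDerivAt.mem_submodule {E : Type*} [NormedAddCommGroup E] [NormedSpace ℝ E]
    {S : Submodule ℝ E} [FiniteDimensional ℝ S] {f : ℝ → E} {f' : E} {t : ℝ}
    (hf : HasDerivAt f f' t) (hS : ∀ s, f s ∈ S) : f' ∈ S :=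
  S.closed_of_finiteDimensional.mem_of_tendsto (hasDerivAt_iff_tendsto_slope.1 hf)
    (Filter.Eventually.of_forall fun s => S.smul_mem _ (S.sub_mem (hS s) (hS t)))

open MeasureTheory in
/-- A compact group of affine transformations of a finite-dimensional space has a fixed point: the
average of an orbit over Haar measure. -/
theorem exists_fixedPoint_of_compact {C E : Type*} [Group C] [TopologicalSpace C]
    [IsTopologicalGroup C] [CompactSpace C] [NormedAddCommGroup E] [NormedSpace ℝ E]
    [FiniteDimensional ℝ E] {ρ : C → Module.End ℝ E} {x : C → E} (hxc : Continuous x)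
    (hx : ∀ a b, x (a * b) = x a + ρ a (x b)) (P : Submodule ℝ E) (hP : ∀ c, x c ∈ P) :
    ∃ y ∈ P, ∀ c, x c + ρ c y = y := by
  let _ : MeasurableSpace C := borel C
  have : BorelSpace C := ⟨rfl⟩
  let μ : Measure C := Measure.haarMeasure ⊤
  have : IsProbabilityMeasure μ := ⟨Measure.haarMeasure_self⟩
  have hint : Integrable x μ :=
    hxc.integrable_of_hasCompactSupport (HasCompactSupport.of_compactSpace x)
  refine ⟨∫ c, x c ∂μ, P.convex.integral_mem P.closed_of_finiteDimensional
    (Filter.Eventually.of_forall hP) hint, fun a => ?_⟩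
  have h1 : ∫ c, x (a * c) ∂μ = ∫ c, x c ∂μ := integral_mul_left_eq_self x a
  have h2 : ∫ c, ρ a (x c) ∂μ = ρ a (∫ c, x c ∂μ) :=
    (LinearMap.toContinuousLinearMap (ρ a)).integral_comp_comm hint
  have hint2 : Integrable (fun c => ρ a (x c)) μ :=
    (LinearMap.toContinuousLinearMap (ρ a)).integrable_comp hint
  simp only [hx] at h1
  rw [integral_add (integrable_const _) hint2, h2] at h1
  simpa using h1

namespace CartanMotion.MotionGroup

open Filter Topology

variable {V : Type*} [NormedAddCommGroup V] [InnerProductSpace ℝ V] [FiniteDimensional ℝ V]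
  {G : Subgroup (V →L[ℝ] V)ˣ}

/-- `K` as a subgroup of `G_θ`. -/
def subgroupK (G : Subgroup (V →L[ℝ] V)ˣ) : Subgroup (MotionGroup G) where
  carrier := setK G
  one_mem' := rfl
  mul_mem' {a b} (ha hb) := by
    change a.X + Ad G a.k b.X = 0
    rw [show a.X = 0 from ha, show b.X = 0 from hb, map_zero, add_zero]
  inv_mem' {a} ha := by
    change -Ad G a.k⁻¹ a.X = 0
    rw [show a.X = 0 from ha, map_zero, neg_zero]

/-- Conjugation by the translation `Y`. -/
def conjP (Y : cartanP G) : MotionGroup G →* MotionGroup G :=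
  (MulAut.conj (ofP Y)).toMonoidHom

theorem conjP_apply (Y : cartanP G) (a : MotionGroup G) :
    conjP Y a = ⟨a.k, Y + a.X - Ad G a.k Y⟩ := by
  change ofP Y * a * (ofP Y)⁻¹ = _
  rw [← ofP_neg]
  ext1 <;> simp [sub_eq_add_neg]

theorem conjP_neg_conjP (Y : cartanP G) (a : MotionGroup G) : conjP (-Y) (conjP Y a) = a := by
  rw [conjP_apply, conjP_apply]
  ext1
  · rfl
  · simp only [map_neg]
    abel

theorem continuous_conjP (Y : cartanP G) : Continuous (conjP Y) :=
  (continuous_const.mul continuous_id).mul continuous_const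

/-- The differential of `conjP Y` at the identity. -/
noncomputable def dConjP (Y : cartanP G) :
    (V →L[ℝ] V) × (V →L[ℝ] V) →ₗ[ℝ] (V →L[ℝ] V) × (V →L[ℝ] V) where
  toFun v := (v.1, v.2 - (v.1 * (Y : V →L[ℝ] V) + (Y : V →L[ℝ] V) * star v.1))
  map_add' v w := by
    ext1
    · rfl
    · simp only [Prod.snd_add, Prod.fst_add, star_add, add_mul, mul_add]; abel
  map_smul' c v := by
    ext1
    · rfl
    · simp only [Prod.smul_snd, Prod.smul_fst, star_smul, smul_mul_assoc, mul_smul_comm,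
        RingHom.id_apply, smul_sub, smul_add, star_trivial]

theorem dConjP_injective (Y : cartanP G) : Function.Injective (dConjP Y) := by
  intro v w h
  have h1 : (dConjP Y v).1 = (dConjP Y w).1 := congrArg Prod.fst h
  have h2 := congrArg Prod.snd h
  change v.1 = w.1 at h1
  simp only [dConjP, LinearMap.coe_mk, AddHom.coe_mk, h1, sub_left_inj] at h2
  exact Prod.ext h1 h2

theorem dConjP_mem_tangentSpace (Y : cartanP G) {H : Subgroup (MotionGroup G)}
    {v : (V →L[ℝ] V) × (V →L[ℝ] V)} (hv : v ∈ tangentSpace H) :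
    dConjP Y v ∈ tangentSpace (H.map (conjP Y)) := by
  obtain ⟨γ, hγ, hγ0, h1, h2⟩ := hv
  refine ⟨fun t => conjP Y (γ t), fun t => ⟨γ t, hγ t, rfl⟩,
    by simp only [hγ0, map_one], ?_, ?_⟩
  · simpa only [conjP_apply] using! h1
  · have h := (h2.const_add (Y : V →L[ℝ] V)).sub
      ((h1.mul_const (Y : V →L[ℝ] V)).mul h1.star)
    simp only [hγ0, one_k, OneMemClass.coe_one, Units.val_one, one_mul, star_one, mul_one] at h
    refine h.congr_of_eventuallyEq (Eventually.of_forall fun t => ?_)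
    have hc := coe_inv_k (γ t)
    simp only [conjP_apply]
    change (Y : V →L[ℝ] V) + ((γ t).X : V →L[ℝ] V) - _ * _ * _ = _
    rw [hc]
    rfl

theorem lieDim_le_lieDim_map_conjP (Y : cartanP G) (H : Subgroup (MotionGroup G)) :
    lieDim H ≤ lieDim (H.map (conjP Y)) := by
  rw [lieDim, lieDim, (Submodule.equivMapOfInjective _ (dConjP_injective Y) _).finrank_eq]
  refine Submodule.finrank_mono ?_
  rintro _ ⟨v, hv, rfl⟩
  exact dConjP_mem_tangentSpace Y hv

theorem map_conjP_neg (Y : cartanP G) (H : Subgroup (MotionGroup G)) :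
    (H.map (conjP Y)).map (conjP (-Y)) = H := by
  rw [Subgroup.map_map]
  convert! H.map_id
  ext1 a
  exact conjP_neg_conjP Y a

theorem lieDim_map_conjP (Y : cartanP G) (H : Subgroup (MotionGroup G)) :
    lieDim (H.map (conjP Y)) = lieDim H := by
  refine le_antisymm ?_ (lieDim_le_lieDim_map_conjP Y H)
  have := lieDim_le_lieDim_map_conjP (-Y) (H.map (conjP Y))
  rwa [map_conjP_neg] at this

theorem nsmul_X_of_mem {D : Subgroup (MotionGroup G)} {X : cartanP G} (hX : ofP X ∈ D) (n : ℕ) :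
    ofP (n • X) ∈ D := by
  induction n with
  | zero => rw [zero_smul]; exact D.one_mem
  | succ n ih => rw [succ_nsmul, ofP_add]; exact D.mul_mem ih hX

/-- A compact subgroup contains no translations. -/
theorem eq_zero_of_ofP_mem_of_isCompact {D : Subgroup (MotionGroup G)}
    (hD : IsCompact (D : Set (MotionGroup G))) {X : cartanP G} (hX : ofP X ∈ D) : X = 0 := by
  obtain ⟨R, hR⟩ := (hD.image continuous_X).isBounded.exists_norm_le
  by_contra hne
  have hpos : 0 < ‖X‖ := norm_pos_iff.2 hne
  obtain ⟨n, hn⟩ := exists_nat_gt (R / ‖X‖)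
  have h1 : ‖n • X‖ ≤ R := hR _ ⟨_, nsmul_X_of_mem hX n, rfl⟩
  have h2 : ‖n • X‖ = n * ‖X‖ := by
    rw [← Nat.cast_smul_eq_nsmul ℝ, norm_smul_cartanP, Nat.abs_cast]
  rw [h2] at h1
  rw [div_lt_iff₀ hpos] at hn
  linarith

theorem isCompact_inf_subgroupK {H : Subgroup (MotionGroup G)}
    (hG : IsClosed (G : Set (V →L[ℝ] V)ˣ)) (hH : IsClosed (H : Set (MotionGroup G))) :
    IsCompact ((H ⊓ subgroupK G : Subgroup (MotionGroup G)) : Set (MotionGroup G)) := by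
  refine (isCompact_norm_le hG 0).of_isClosed_subset
    (hH.inter (isClosed_singleton.preimage continuous_X)) fun a ha => ?_
  exact (norm_le_zero_iff.2 ha.2 : ‖a.X‖ ≤ 0)

namespace IsSplit

variable {H : Subgroup (MotionGroup G)} {P : Submodule ℝ (cartanP G)}

theorem isMaximalCompact_inf_subgroupK (hG : IsClosed (G : Set (V →L[ℝ] V)ˣ))
    (hH : IsClosed (H : Set (MotionGroup G))) (h : IsSplit H P) :
    IsMaximalCompact H (H ⊓ subgroupK G) := by
  refine ⟨⟨inf_le_left, isCompact_inf_subgroupK hG hH⟩, fun D ⟨hDH, hDc⟩ hle a ha => ?_⟩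
  refine ⟨hDH ha, ?_⟩
  have h1 : (⟨a.k, 0⟩ : MotionGroup G) ∈ D := hle ⟨((h a).1 (hDH ha)).1, rfl⟩
  refine eq_zero_of_ofP_mem_of_isCompact hDc (X := a.X) ?_
  have : ofP a.X = a * (⟨a.k, 0⟩ : MotionGroup G)⁻¹ := by
    rw [eq_mul_inv_iff_mul_eq]; ext1 <;> simp
  rw [this]
  exact D.mul_mem ha (D.inv_mem h1)

/-- Every maximal compact subgroup is conjugate to the rotational part by a translation. -/
theorem exists_eq_map_conjP (hG : IsClosed (G : Set (V →L[ℝ] V)ˣ))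
    (hH : IsClosed (H : Set (MotionGroup G))) (h : IsSplit H P) {C : Subgroup (MotionGroup G)}
    (hC : IsMaximalCompact H C) : ∃ Y, C = (H ⊓ subgroupK G).map (conjP Y) := by
  have : CompactSpace C := isCompact_iff_compactSpace.1 hC.prop.2
  obtain ⟨Y, hYP, hY⟩ := exists_fixedPoint_of_compact (C := C)
    (ρ := fun c => Ad G (c : MotionGroup G).k) (x := fun c => (c : MotionGroup G).X)
    (continuous_X.comp continuous_subtype_val) (fun a b => rfl) P
    (fun c => ((h _).1 (hC.prop.1 c.2)).2)
  have hconjH : ∀ Z ∈ P, ∀ a ∈ H, conjP Z a ∈ H := fun Z hZ a ha =>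
    H.mul_mem (H.mul_mem (h.ofP_mem_iff.2 hZ) ha) (H.inv_mem (h.ofP_mem_iff.2 hZ))
  refine ⟨Y, hC.eq_of_le ⟨?_, ?_⟩ fun c hc => ?_⟩
  · rintro _ ⟨a, ha, rfl⟩
    exact hconjH Y hYP a ha.1
  · exact (isCompact_inf_subgroupK hG hH).image (continuous_conjP Y)
  · refine ⟨conjP (-Y) c, ⟨hconjH _ (P.neg_mem hYP) c (hC.prop.1 hc), ?_⟩, ?_⟩
    · change (conjP (-Y) c).X = 0
      rw [conjP_apply]
      have := hY ⟨c, hc⟩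
      simp only at this
      rw [map_neg, sub_neg_eq_add, add_assoc, this, neg_add_cancel]
    · have := conjP_neg_conjP (-Y) c
      rwa [neg_neg] at this

theorem lieDim_eq (h : IsSplit H P) :
    lieDim H = lieDim (H ⊓ subgroupK G) + Module.finrank ℝ P := by
  let Q : Submodule ℝ (V →L[ℝ] V) := P.map (cartanP G).subtype
  let N : Submodule ℝ ((V →L[ℝ] V) × (V →L[ℝ] V)) := Q.map (LinearMap.inr ℝ _ _)
  have hN : Module.finrank ℝ N = Module.finrank ℝ P := by
    rw [← (Submodule.equivMapOfInjective _ LinearMap.inr_injective Q).finrank_eq,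
      ← (Submodule.equivMapOfInjective _ (cartanP G).injective_subtype P).finrank_eq]
  have hsnd : ∀ v ∈ tangentSpace (H ⊓ subgroupK G), v.2 = 0 := by
    rintro v ⟨γ, hγ, -, -, h2⟩
    have e : (fun t => ((γ t).X : V →L[ℝ] V)) = fun _ => 0 := by
      ext1 t
      rw [show (γ t).X = 0 from (hγ t).2]; rfl
    rw [e] at h2
    exact h2.unique (hasDerivAt_const _ _)
  have hsup : tangentSpace H = tangentSpace (H ⊓ subgroupK G) ⊔ N := by
    apply le_antisymm
    · rintro v ⟨γ, hγ, hγ0, h1, h2⟩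
      have hv2 : v.2 ∈ Q := h2.mem_submodule fun t => ⟨_, ((h _).1 (hγ t)).2, rfl⟩
      have hv1 : (v.1, (0 : V →L[ℝ] V)) ∈ tangentSpace (H ⊓ subgroupK G) :=
        ⟨fun t => ⟨(γ t).k, 0⟩, fun t => ⟨((h _).1 (hγ t)).1, rfl⟩,
          by simp only [hγ0]; rfl, h1,
          hasDerivAt_const _ _⟩
      have e : v = (v.1, 0) + (0, v.2) := by simp
      rw [e]
      exact Submodule.add_mem_sup hv1 ⟨v.2, hv2, rfl⟩
    · refine sup_le ?_ ?_
      · rintro v ⟨γ, hγ, hγ'⟩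
        exact ⟨γ, fun t => (hγ t).1, hγ'⟩
      · rintro _ ⟨_, ⟨X, hX, rfl⟩, rfl⟩
        refine ⟨fun t => ofP (t • X), fun t => h.ofP_mem_iff.2 (P.smul_mem t hX), ?_,
          hasDerivAt_const _ _, ?_⟩
        · ext1 <;> simp
        · have := (hasDerivAt_id (0 : ℝ)).smul_const (X : V →L[ℝ] V)
          rwa [one_smul] at this
  have hinf : tangentSpace (H ⊓ subgroupK G) ⊓ N = ⊥ := by
    rw [eq_bot_iff]
    rintro _ ⟨hv, ⟨w, hw, rfl⟩⟩
    have : w = 0 := hsnd _ hv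
    rw [this, map_zero]
    exact Submodule.zero_mem _
  have := Submodule.finrank_sup_add_finrank_inf_eq (tangentSpace (H ⊓ subgroupK G)) N
  rw [hinf, finrank_bot, add_zero, hN] at this
  rw [lieDim, lieDim, hsup, this]

theorem noncompactDim_eq (hG : IsClosed (G : Set (V →L[ℝ] V)ˣ))
    (hH : IsClosed (H : Set (MotionGroup G))) (h : IsSplit H P) :
    noncompactDim H = Module.finrank ℝ P := by
  have hex : ∃ C, IsMaximalCompact H C := ⟨_, isMaximalCompact_inf_subgroupK hG hH h⟩
  obtain ⟨Y, hY⟩ := h.exists_eq_map_conjP hG hH hex.choose_spec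
  rw [noncompactDim, dif_pos hex, hY, lieDim_map_conjP, h.lieDim_eq, Nat.add_sub_cancel_left]

end IsSplit

end CartanMotion.MotionGroup

/-! ### Conjugacy of maximal abelian subspaces -/

open Filter Topology

theorem norm_pow_sub_pow_le {A : Type*} [NormedRing A] (h1 : ‖(1 : A)‖ ≤ 1) {a b : A} {M : ℝ}
    (hM : 1 ≤ M) (ha : ‖a‖ ≤ M) (hb : ‖b‖ ≤ M) (n : ℕ) :
    ‖a ^ n - b ^ n‖ ≤ n * M ^ n * ‖a - b‖ := by
  have hpow : ∀ n : ℕ, ‖a ^ n‖ ≤ M ^ n := by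
    intro n
    induction n with
    | zero => simpa using h1
    | succ n ih =>
      rw [pow_succ, pow_succ]
      exact (norm_mul_le _ _).trans (by gcongr)
  induction n with
  | zero => simp
  | succ n ih =>
    have e : a ^ (n + 1) - b ^ (n + 1) = a ^ n * (a - b) + (a ^ n - b ^ n) * b := by
      rw [pow_succ, pow_succ]; noncomm_ring
    have h0 : 0 ≤ M ^ n := by positivity
    calc _ ≤ ‖a ^ n‖ * ‖a - b‖ + ‖a ^ n - b ^ n‖ * ‖b‖ := by
          rw [e]; exact (norm_add_le _ _).trans (add_le_add (norm_mul_le _ _) (norm_mul_le _ _))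
      _ ≤ (M ^ n * M) * ‖a - b‖ + (n * M ^ n * ‖a - b‖) * M := by
          gcongr
          exact (hpow n).trans (le_mul_of_one_le_right h0 hM)
      _ = _ := by push_cast; ring

/-- The exponential of the initial velocity of a curve through `1` is the limit of powers of
points of the curve. -/
theorem tendsto_pow_exp_of_hasDerivAt {A : Type*} [NormedRing A] [NormedAlgebra ℝ A]
    [CompleteSpace A] (h1 : ‖(1 : A)‖ ≤ 1) {γ : ℝ → A} {X : A} (h0 : γ 0 = 1)
    (hγ : HasDerivAt γ X 0) :
    Tendsto (fun n : ℕ => γ (1 / ((n : ℝ) + 1)) ^ (n + 1)) atTop (𝓝 (NormedSpace.exp X)) := by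
  let _ : NormedAlgebra ℚ A := NormedAlgebra.restrictScalars ℚ ℝ A
  have hexp : HasDerivAt (fun t : ℝ => NormedSpace.exp (t • X)) X 0 := by
    have := hasDerivAt_exp_smul_const (𝕂 := ℝ) X (0 : ℝ)
    simpa using this
  have ht : Tendsto (fun n : ℕ => 1 / ((n : ℝ) + 1)) atTop (𝓝[≠] 0) :=
    tendsto_nhdsWithin_iff.2 ⟨tendsto_one_div_add_atTop_nhds_zero_nat,
      Eventually.of_forall fun n => by
        have : (0 : ℝ) < 1 / ((n : ℝ) + 1) := by positivity
        exact this.ne'⟩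
  have slope : ∀ f : ℝ → A, HasDerivAt f X 0 → f 0 = 1 →
      Tendsto (fun n : ℕ => ((n : ℝ) + 1) • (f (1 / ((n : ℝ) + 1)) - 1)) atTop (𝓝 X) := by
    intro f hf hf0
    have := (hasDerivAt_iff_tendsto_slope_zero.1 hf).comp ht
    refine this.congr fun n => ?_
    simp [hf0]
  have s1 := slope γ hγ h0
  have s2 := slope _ hexp (by simp)
  have hbound : ∀ f : ℝ → A, Tendsto (fun n : ℕ => ((n : ℝ) + 1) • (f (1 / ((n : ℝ) + 1)) - 1))
      atTop (𝓝 X) → ∀ᶠ n : ℕ in atTop,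
        ‖f (1 / ((n : ℝ) + 1))‖ ≤ 1 + (‖X‖ + 1) / ((n : ℝ) + 1) := by
    intro f hf
    filter_upwards [hf.norm.eventually (ge_mem_nhds (lt_add_one ‖X‖))] with n hn
    have hp : (0 : ℝ) < (n : ℝ) + 1 := by positivity
    rw [norm_smul, Real.norm_eq_abs, abs_of_pos hp] at hn
    have e : f (1 / ((n : ℝ) + 1)) = 1 + (f (1 / ((n : ℝ) + 1)) - 1) := by abel
    rw [e]
    refine (norm_add_le _ _).trans (add_le_add h1 ?_)
    rw [le_div_iff₀ hp, mul_comm]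
    exact hn
  have hdiff : Tendsto (fun n : ℕ => Real.exp (‖X‖ + 1) *
      ‖((n : ℝ) + 1) • (γ (1 / ((n : ℝ) + 1)) - NormedSpace.exp ((1 / ((n : ℝ) + 1)) • X))‖)
      atTop (𝓝 0) := by
    have h := (s1.sub s2).norm
    rw [sub_self, norm_zero] at h
    have h2 := h.const_mul (Real.exp (‖X‖ + 1))
    rw [mul_zero] at h2
    refine h2.congr fun n => ?_
    rw [← smul_sub, sub_sub_sub_cancel_right]
  rw [tendsto_iff_norm_sub_tendsto_zero]
  refine squeeze_zero' (Eventually.of_forall fun _ => norm_nonneg _) ?_ hdiff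
  filter_upwards [hbound _ s1,
    hbound (fun t => NormedSpace.exp (t • X)) s2] with n hn1 hn2
  have hp : (0 : ℝ) < (n : ℝ) + 1 := by positivity
  have hpow : NormedSpace.exp ((1 / ((n : ℝ) + 1)) • X) ^ (n + 1) = NormedSpace.exp X := by
    rw [← NormedSpace.exp_nsmul, ← Nat.cast_smul_eq_nsmul ℝ, smul_smul]
    push_cast
    rw [mul_one_div_cancel hp.ne', one_smul]
  have hM : (1 + (‖X‖ + 1) / ((n : ℝ) + 1)) ^ (n + 1) ≤ Real.exp (‖X‖ + 1) := by
    have h := Real.add_one_le_exp ((‖X‖ + 1) / ((n : ℝ) + 1))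
    rw [add_comm] at h
    calc _ ≤ Real.exp ((‖X‖ + 1) / ((n : ℝ) + 1)) ^ (n + 1) := by gcongr
      _ = _ := by
        rw [← Real.exp_nat_mul]; push_cast; rw [mul_div_cancel₀ _ hp.ne']
  rw [← hpow]
  refine (norm_pow_sub_pow_le h1 (le_add_of_nonneg_right (by positivity)) hn1 hn2 _).trans ?_
  rw [norm_smul, Real.norm_eq_abs, abs_of_pos hp]
  push_cast
  rw [mul_comm ((n : ℝ) + 1), mul_assoc]
  exact mul_le_mul_of_nonneg_right hM (by positivity)

namespace CartanMotion

variable {V : Type*} [NormedAddCommGroup V] [InnerProductSpace ℝ V] {G : Subgroup (V →L[ℝ] V)ˣ}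

theorem conj_mem_lieAlg {g : (V →L[ℝ] V)ˣ} (hg : g ∈ G) {Y : V →L[ℝ] V} (hY : Y ∈ lieAlg G) :
    (g : V →L[ℝ] V) * Y * ((g⁻¹ : (V →L[ℝ] V)ˣ) : V →L[ℝ] V) ∈ lieAlg G := by
  obtain ⟨γ, hγ, hγ0, hd⟩ := hY
  refine ⟨fun t => g * γ t * g⁻¹, fun t => G.mul_mem (G.mul_mem hg (hγ t)) (G.inv_mem hg),
    by simp [hγ0], ?_⟩
  simpa using (hd.const_mul (g : V →L[ℝ] V)).mul_const ((g⁻¹ : (V →L[ℝ] V)ˣ) : V →L[ℝ] V)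

/-- The trace of an operator, as a linear functional. -/
noncomputable def traceL : (V →L[ℝ] V) →ₗ[ℝ] ℝ :=
  LinearMap.trace ℝ V ∘ₗ ContinuousLinearMap.coeLM ℝ

theorem traceL_mul_comm (A B : V →L[ℝ] V) : traceL (A * B) = traceL (B * A) :=
  LinearMap.trace_mul_comm ℝ (A : V →ₗ[ℝ] V) (B : V →ₗ[ℝ] V)

variable [FiniteDimensional ℝ V]

theorem exp_neg_mul_exp (X : V →L[ℝ] V) : NormedSpace.exp (-X) * NormedSpace.exp X = 1 := by
  let _ : NormedAlgebra ℚ (V →L[ℝ] V) := NormedAlgebra.restrictScalars ℚ ℝ _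
  rw [← NormedSpace.exp_add_of_commute (Commute.refl X).neg_left, neg_add_cancel,
    NormedSpace.exp_zero]

/-- A closed linear group contains the exponentials of its velocities. -/
theorem exists_coe_eq_exp (hG : IsClosed (G : Set (V →L[ℝ] V)ˣ)) {X : V →L[ℝ] V}
    (hX : X ∈ lieAlg G) : ∃ g ∈ G, (g : V →L[ℝ] V) = NormedSpace.exp X ∧
      ((g⁻¹ : (V →L[ℝ] V)ˣ) : V →L[ℝ] V) = NormedSpace.exp (-X) := by
  obtain ⟨γ, hγ, hγ0, hd⟩ := hX
  let u : (V →L[ℝ] V)ˣ := ⟨NormedSpace.exp X, NormedSpace.exp (-X),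
    by simpa using exp_neg_mul_exp (-X), exp_neg_mul_exp X⟩
  have hlim := tendsto_pow_exp_of_hasDerivAt ContinuousLinearMap.norm_id_le
    (by rw [hγ0, Units.val_one]) hd
  refine ⟨u, ?_, rfl, rfl⟩
  have hu : Tendsto (fun n : ℕ => γ (1 / ((n : ℝ) + 1)) ^ (n + 1)) atTop (𝓝 u) := by
    rw [Units.isOpenEmbedding_val.isEmbedding.tendsto_nhds_iff]
    exact hlim
  exact hG.mem_of_tendsto hu (Eventually.of_forall fun n => G.pow_mem (hγ _) _)

theorem hasDerivAt_exp_conj (X Y : V →L[ℝ] V) :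
    HasDerivAt (fun t : ℝ => NormedSpace.exp (t • X) * Y * NormedSpace.exp (-(t • X)))
      (X * Y - Y * X) 0 := by
  let _ : NormedAlgebra ℚ (V →L[ℝ] V) := NormedAlgebra.restrictScalars ℚ ℝ _
  have h1 : HasDerivAt (fun t : ℝ => NormedSpace.exp (t • X)) X 0 := by
    simpa using hasDerivAt_exp_smul_const (𝕂 := ℝ) X (0 : ℝ)
  have h2 : HasDerivAt (fun t : ℝ => NormedSpace.exp (-(t • X))) (-X) 0 := by
    simpa using hasDerivAt_exp_smul_const (𝕂 := ℝ) (-X) (0 : ℝ)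
  have h := (h1.mul_const Y).mul h2
  simp only [zero_smul, neg_zero, NormedSpace.exp_zero, mul_one, one_mul, mul_neg,
    ← sub_eq_add_neg] at h
  exact h

theorem commutator_mem_lieAlg (hG : IsClosed (G : Set (V →L[ℝ] V)ˣ)) {X Y : V →L[ℝ] V}
    (hX : X ∈ lieAlg G) (hY : Y ∈ lieAlg G) : X * Y - Y * X ∈ lieAlg G := by
  refine (hasDerivAt_exp_conj X Y).mem_submodule fun t => ?_
  obtain ⟨g, hg, h1, h2⟩ := exists_coe_eq_exp hG ((lieAlg G).smul_mem t hX)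
  rw [← h1, ← h2]
  exact conj_mem_lieAlg hg hY

theorem traceL_star_mul_self (A : V →L[ℝ] V) :
    traceL (star A * A) = ∑ i, ‖A (stdOrthonormalBasis ℝ V i)‖ ^ 2 := by
  change LinearMap.trace ℝ V ((star A * A : V →L[ℝ] V) : V →ₗ[ℝ] V) = _
  rw [LinearMap.trace_eq_sum_inner _ (stdOrthonormalBasis ℝ V)]
  refine Finset.sum_congr rfl fun i _ => ?_
  change inner ℝ _ (ContinuousLinearMap.adjoint A (A _)) = _
  rw [ContinuousLinearMap.adjoint_inner_right, real_inner_self_eq_norm_sq]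

theorem eq_zero_of_traceL_star_mul_self {A : V →L[ℝ] V} (h : traceL (star A * A) = 0) :
    A = 0 := by
  rw [traceL_star_mul_self, Finset.sum_eq_zero_iff_of_nonneg fun _ _ => by positivity] at h
  have : (A : V →ₗ[ℝ] V) = 0 := (stdOrthonormalBasis ℝ V).toBasis.ext fun i => by
    simpa using h i (Finset.mem_univ i)
  exact ContinuousLinearMap.coe_injective this

open Module.End in
/-- A commuting space of self-adjoint operators contains a regular element: one that takes
distinct values on distinct joint weights, so that its centralizer commutes with the whole space. -/
theorem exists_regular (S : Submodule ℝ (V →L[ℝ] V)) (hsym : ∀ B ∈ S, star B = B)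
    (hcomm : ∀ A ∈ S, ∀ B ∈ S, A * B = B * A) :
    ∃ H ∈ S, ∀ X : V →L[ℝ] V, X * H = H * X → ∀ B ∈ S, X * B = B * X := by
  let T : S → V →ₗ[ℝ] V := fun B => ((B : V →L[ℝ] V) : V →ₗ[ℝ] V)
  have hTs : ∀ B, (T B).IsSymmetric := fun B =>
    ContinuousLinearMap.isSelfAdjoint_iff_isSymmetric.1 (hsym B B.2)
  have hTc : Pairwise (Function.onFun Commute T) := fun A B _ => by
    have := hcomm A A.2 B B.2
    exact congrArg (fun L : V →L[ℝ] V => (L : V →ₗ[ℝ] V)) this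
  let J : (S → ℝ) → Submodule ℝ V := fun χ => ⨅ B, eigenspace (T B) (χ B)
  have hJ : ∀ χ v, v ∈ J χ ↔ ∀ B : S, (B : V →L[ℝ] V) v = χ B • v := fun χ v => by
    simp [J, T, Submodule.mem_iInf]
  have htop : ⨆ χ, J χ = ⊤ := LinearMap.IsSymmetric.iSup_iInf_eq_top_of_commute hTs hTc
  have hfin : {χ | J χ ≠ ⊥}.Finite := WellFoundedGT.finite_ne_bot_of_iSupIndep
    (LinearMap.IsSymmetric.orthogonalFamily_iInf_eigenspaces hTs).independent
  have hlin : ∀ χ, J χ ≠ ⊥ → ∀ (a b : ℝ) (A B : S), χ (a • A + b • B) = a * χ A + b * χ B := by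
    intro χ hχ a b A B
    obtain ⟨v, hv, hv0⟩ := Submodule.exists_mem_ne_zero_of_ne_bot hχ
    have h := (hJ χ v).1 hv
    have h1 := h (a • A + b • B)
    have h2 : ((a • A + b • B : S) : V →L[ℝ] V) v = (a * χ A + b * χ B) • v := by
      rw [Submodule.coe_add, Submodule.coe_smul, Submodule.coe_smul, add_apply, smul_apply,
        smul_apply, h A, h B, smul_smul, smul_smul, add_smul]
    exact smul_left_injective ℝ hv0 (h1.symm.trans h2)
  have := hfin.to_subtype
  let ι := {p : {χ | J χ ≠ ⊥} × {χ | J χ ≠ ⊥} // p.1 ≠ p.2}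
  let D : ι → Submodule ℝ S := fun p =>
    { carrier := {B | (p.1.1 : S → ℝ) B = (p.1.2 : S → ℝ) B}
      zero_mem' := by
        have h1 := hlin _ p.1.1.2 0 0 0 0
        have h2 := hlin _ p.1.2.2 0 0 0 0
        simp only [zero_smul, add_zero, zero_mul] at h1 h2
        exact h1.trans h2.symm
      add_mem' := fun {A B} hA hB => by
        have h1 := hlin _ p.1.1.2 1 1 A B
        have h2 := hlin _ p.1.2.2 1 1 A B
        simp only [one_smul, one_mul] at h1 h2
        exact h1.trans ((congrArg₂ _ hA hB).trans h2.symm)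
      smul_mem' := fun c A hA => by
        have h1 := hlin _ p.1.1.2 c 0 A 0
        have h2 := hlin _ p.1.2.2 c 0 A 0
        simp only [zero_smul, add_zero, zero_mul] at h1 h2
        exact h1.trans ((congrArg _ hA).trans h2.symm) }
  obtain ⟨H, hH⟩ : ∃ H : S, ∀ p, H ∉ D p := by
    by_contra! hcon
    obtain ⟨p, hp⟩ := Subspace.exists_eq_top_of_iUnion_eq_univ (p := D)
      (Set.eq_univ_of_forall fun H => Set.mem_iUnion.2 (hcon H))
    refine p.2 (Subtype.ext (funext fun B => ?_))
    have : B ∈ D p := by rw [hp]; trivial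
    exact this
  have hsep : ∀ χ χ', J χ ≠ ⊥ → J χ' ≠ ⊥ → χ ≠ χ' → χ H ≠ χ' H := fun χ χ' h h' hne heq =>
    hH ⟨(⟨χ, h⟩, ⟨χ', h'⟩), fun he => hne (congrArg Subtype.val he)⟩ heq
  -- an eigenspace of `H` is a joint eigenspace
  have heig : ∀ χ, J χ ≠ ⊥ → ∀ u, (H : V →L[ℝ] V) u = χ H • u → u ∈ J χ := by
    intro χ hχ u hu
    set w := u - (J χ).starProjection u with hw
    have hPu : (J χ).starProjection u ∈ J χ := Submodule.starProjection_apply_mem _ _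
    have hwH : (H : V →L[ℝ] V) w = χ H • w := by
      rw [hw, map_sub, hu, (hJ _ _).1 hPu H, smul_sub]
    have hwo : w ∈ (⨆ χ, J χ)ᗮ := by
      rw [← Submodule.iInf_orthogonal, Submodule.mem_iInf]
      intro χ'
      by_cases h : χ' = χ
      · rw [h]; exact Submodule.sub_starProjection_mem_orthogonal _
      by_cases h' : J χ' = ⊥
      · rw [h']; simp
      intro v hv
      have e := hTs H v w
      change inner ℝ ((H : V →L[ℝ] V) v) w = inner ℝ v ((H : V →L[ℝ] V) w) at e
      rw [hwH, (hJ _ _).1 hv H, real_inner_smul_left, real_inner_smul_right] at e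
      have e2 : (χ' H - χ H) * inner ℝ v w = 0 := by rw [sub_mul, e, sub_self]
      exact (mul_eq_zero.1 e2).resolve_left (sub_ne_zero.2 (hsep _ _ h' hχ h))
    rw [htop, Submodule.top_orthogonal_eq_bot, Submodule.mem_bot] at hwo
    rw [sub_eq_zero.1 hwo]
    exact hPu
  refine ⟨H, H.2, fun X hX B hB => ?_⟩
  ext1 v
  have hv : v ∈ ⨆ χ, J χ := by rw [htop]; trivial
  induction hv using Submodule.iSup_induction' with
  | zero => simp
  | add x y _ _ hx hy => rw [map_add, map_add, hx, hy]
  | mem χ v hv =>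
    by_cases h0 : J χ = ⊥
    · rw [h0, Submodule.mem_bot] at hv
      simp [hv]
    have hXv : X v ∈ J χ := heig χ h0 _ (by
      have := congrArg (fun L : V →L[ℝ] V => L v) hX
      simp only [mul_apply_eq_comp] at this
      rw [← this, (hJ _ _).1 hv H, map_smul])
    rw [mul_apply_eq_comp, mul_apply_eq_comp, (hJ _ _).1 hXv ⟨B, hB⟩, (hJ _ _).1 hv ⟨B, hB⟩,
      map_smul]

theorem mul_comm_of_isMaximalAbelian {𝔞 : Submodule ℝ (cartanP G)}
    (h𝔞 : MotionGroup.IsMaximalAbelian 𝔞) {X Y : cartanP G} (hX : X ∈ 𝔞) (hY : Y ∈ 𝔞) :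
    (X : V →L[ℝ] V) * Y = Y * X :=
  sub_eq_zero.1 (h𝔞.prop X hX Y hY)

theorem mem_of_forall_mul_comm {𝔞 : Submodule ℝ (cartanP G)}
    (h𝔞 : MotionGroup.IsMaximalAbelian 𝔞) {X : cartanP G}
    (hX : ∀ Y ∈ 𝔞, (X : V →L[ℝ] V) * Y = Y * X) : X ∈ 𝔞 := by
  refine h𝔞.le_of_ge (y := 𝔞 ⊔ Submodule.span ℝ {X}) ?_ le_sup_left
    (Submodule.mem_sup_right (Submodule.mem_span_singleton_self X))
  intro A hA B hB
  obtain ⟨A', hA', _, hc, rfl⟩ := Submodule.mem_sup.1 hA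
  obtain ⟨c, rfl⟩ := Submodule.mem_span_singleton.1 hc
  obtain ⟨B', hB', _, hd, rfl⟩ := Submodule.mem_sup.1 hB
  obtain ⟨d, rfl⟩ := Submodule.mem_span_singleton.1 hd
  refine sub_eq_zero.2 ?_
  have h1 := mul_comm_of_isMaximalAbelian h𝔞 hA' hB'
  have h2 := hX A' hA'
  have h3 := hX B' hB'
  simp only [Submodule.coe_add, Submodule.coe_smul, mul_add, add_mul, smul_mul_assoc,
    mul_smul_comm, h1, h2, h3, smul_add]
  rw [smul_comm c d ((X : V →L[ℝ] V) * X)]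
  abel

/-- Every element of `𝔭` is conjugate under `K` to an element of `𝔞`. With `H` regular in `𝔞`, a
maximum of `k ↦ tr (Ad(k) X · H)` is reached at a point where `[Ad(k) X, H] = 0`. -/
theorem exists_Ad_mem (hG : IsClosed (G : Set (V →L[ℝ] V)ˣ)) {𝔞 : Submodule ℝ (cartanP G)}
    (h𝔞 : MotionGroup.IsMaximalAbelian 𝔞) (X : cartanP G) : ∃ k, Ad G k X ∈ 𝔞 := by
  obtain ⟨_, ⟨H, hH, rfl⟩, hreg⟩ := exists_regular (𝔞.map (cartanP G).subtype)
    (by rintro _ ⟨B, -, rfl⟩; exact cartanP_isSelfAdjoint B)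
    (by
      rintro _ ⟨A, hA, rfl⟩ _ ⟨B, hB, rfl⟩
      exact mul_comm_of_isMaximalAbelian h𝔞 hA hB)
  rw [Submodule.subtype_apply] at hreg
  have := compactSpace_cartanK hG
  have hcont : Continuous fun k : cartanK G =>
      traceL ((Ad G k X : V →L[ℝ] V) * (H : V →L[ℝ] V)) := by
    have h1 : Continuous fun k : cartanK G => Ad G k X :=
      MotionGroup.continuous_Ad.comp (continuous_id.prodMk continuous_const)
    exact (traceL (V := V)).continuous_of_finiteDimensional.comp
      ((continuous_subtype_val.comp h1).mul continuous_const)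
  obtain ⟨k, -, hk⟩ := isCompact_univ.exists_isMaxOn ⟨1, Set.mem_univ _⟩ hcont.continuousOn
  refine ⟨k, mem_of_forall_mul_comm h𝔞 fun Y hY => hreg _ ?_ _ ⟨Y, hY, rfl⟩⟩
  set X' : cartanP G := Ad G k X with hX'
  set Z : V →L[ℝ] V := (X' : V →L[ℝ] V) * H - H * X' with hZ
  have hZmem : Z ∈ lieAlg G := commutator_mem_lieAlg hG X'.2.1 H.2.1
  have hZskew : star Z = -Z := by
    rw [hZ, star_sub, star_mul, star_mul, cartanP_isSelfAdjoint, cartanP_isSelfAdjoint, neg_sub]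
  have hder := ((LinearMap.toContinuousLinearMap (traceL (V := V))).hasFDerivAt.comp_hasDerivAt
    (0 : ℝ) ((hasDerivAt_exp_conj Z X').mul_const (H : V →L[ℝ] V)))
  have hmax : IsLocalMax ((LinearMap.toContinuousLinearMap (traceL (V := V))) ∘ fun t : ℝ =>
      NormedSpace.exp (t • Z) * (X' : V →L[ℝ] V) * NormedSpace.exp (-(t • Z)) *
        (H : V →L[ℝ] V)) 0 := by
    refine Eventually.of_forall fun t => ?_
    obtain ⟨g, hg, h1, h2⟩ := exists_coe_eq_exp hG ((lieAlg G).smul_mem t hZmem)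
    have hgK : g ∈ cartanK G := by
      refine mem_cartanK_of_mem_unitary hg ?_
      have hs : star (g : V →L[ℝ] V) = ((g⁻¹ : (V →L[ℝ] V)ˣ) : V →L[ℝ] V) := by
        rw [h1, h2, NormedSpace.star_exp, star_smul, hZskew, star_trivial, smul_neg]
      rw [Unitary.mem_iff, hs]
      simp
    have hle : traceL ((Ad G (⟨g, hgK⟩ * k) X : V →L[ℝ] V) * (H : V →L[ℝ] V)) ≤
        traceL ((Ad G k X : V →L[ℝ] V) * (H : V →L[ℝ] V)) := hk (Set.mem_univ _)
    rw [Ad_mul_apply, ← hX', Ad_coe] at hle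
    change traceL ((g : V →L[ℝ] V) * (X' : V →L[ℝ] V) * ((g⁻¹ : (V →L[ℝ] V)ˣ) : V →L[ℝ] V) *
      (H : V →L[ℝ] V)) ≤ _ at hle
    rw [h1, h2] at hle
    simpa using hle
  have hzero := hmax.hasDerivAt_eq_zero hder
  have htr : traceL (star Z * Z) = 0 := by
    change traceL ((Z * (X' : V →L[ℝ] V) - (X' : V →L[ℝ] V) * Z) * (H : V →L[ℝ] V)) = 0 at hzero
    rw [sub_mul, map_sub, mul_assoc, mul_assoc, traceL_mul_comm (X' : V →L[ℝ] V), ← map_sub,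
      mul_assoc, ← mul_sub, ← hZ] at hzero
    rw [hZskew, neg_mul, map_neg, hzero, neg_zero]
  exact sub_eq_zero.1 (eq_zero_of_traceL_star_mul_self htr)

end CartanMotion

/-! ### Translation parts of discrete subgroups of the motion group -/

open Filter Topology

/-- A subspace that comes within bounded distance of every vector is the whole space. -/
theorem Submodule.eq_top_of_forall_exists_norm_sub_le {E : Type*} [NormedAddCommGroup E]
    [NormedSpace ℝ E] [FiniteDimensional ℝ E] {U : Submodule ℝ E} {R : ℝ}
    (h : ∀ v, ∃ u ∈ U, ‖v - u‖ ≤ R) : U = ⊤ := by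
  rw [eq_top_iff]
  intro v _
  choose u hu hR using fun n : ℕ => h (((n : ℝ) + 1) • v)
  have hlim : Tendsto (fun n : ℕ => (1 / ((n : ℝ) + 1)) • u n) atTop (𝓝 v) := by
    rw [tendsto_iff_norm_sub_tendsto_zero]
    have h0 := (tendsto_one_div_add_atTop_nhds_zero_nat (𝕜 := ℝ)).mul_const R
    rw [zero_mul] at h0
    refine squeeze_zero (fun _ => norm_nonneg _) (fun n => ?_) h0
    have hp : (0 : ℝ) < (n : ℝ) + 1 := by positivity
    have e : (1 / ((n : ℝ) + 1)) • u n - v = (1 / ((n : ℝ) + 1)) • (u n - ((n : ℝ) + 1) • v) := by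
      rw [smul_sub, smul_smul, one_div_mul_cancel hp.ne', one_smul]
    rw [e, norm_smul, Real.norm_eq_abs, abs_of_pos (by positivity), norm_sub_rev]
    exact mul_le_mul_of_nonneg_left (hR n) (by positivity)
  exact U.closed_of_finiteDimensional.mem_of_tendsto hlim
    (Eventually.of_forall fun n => U.smul_mem _ (hu n))

/-- `DiscreteIsometry.exists_submodule_near_orbit` for a normed space whose Euclidean structure is
given by a linear isomorphism onto an inner product space. -/
theorem DiscreteIsometry.exists_submodule_near_orbit_of_linearEquiv {E F : Type*}
    [NormedAddCommGroup E] [InnerProductSpace ℝ E] [NormedAddCommGroup F] [NormedSpace ℝ F]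
    [FiniteDimensional ℝ F] (e : F ≃ₗ[ℝ] E) {Γ : Type*} [Group Γ] {ρ : Γ →* Module.End ℝ F}
    {x : Γ → F} (hρ : ∀ g v w, inner ℝ (e (ρ g v)) (e (ρ g w)) = inner ℝ (e v) (e w))
    (hx : ∀ a b, x (a * b) = x a + ρ a (x b)) (hfin : ∀ R : ℝ, {g : Γ | ‖x g‖ ≤ R}.Finite) :
    ∃ (W : Submodule ℝ F) (R : ℝ), (∀ g, ∃ w ∈ W, ‖x g - w‖ ≤ R) ∧
      ∀ w ∈ W, ∃ g, ‖x g - w‖ ≤ R := by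
  have : FiniteDimensional ℝ E := e.finiteDimensional
  let ρ' : Γ →* (E →L[ℝ] E) :=
    { toFun := fun g => LinearMap.toContinuousLinearMap (e.conj (ρ g))
      map_one' := by
        ext v
        simp [LinearEquiv.conj_apply]
      map_mul' := fun g h => by
        ext v
        simp [LinearEquiv.conj_apply] }
  have hρ' : ∀ g v, ρ' g v = e (ρ g (e.symm v)) := fun g v => rfl
  let ec := e.toContinuousLinearEquiv
  have hsymm : ∀ v : E, ‖e.symm v‖ ≤ ‖(ec.symm : E →L[ℝ] F)‖ * ‖v‖ :=
    (ec.symm : E →L[ℝ] F).le_opNorm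
  obtain ⟨W, R, h1, h2⟩ := DiscreteIsometry.exists_submodule_near_orbit (ρ := ρ')
    (x := fun g => e (x g))
    (fun g v w => by rw [hρ', hρ', hρ, e.apply_symm_apply, e.apply_symm_apply])
    (fun a b => by rw [hρ', hx, map_add, e.symm_apply_apply])
    (fun R => (hfin (‖(ec.symm : E →L[ℝ] F)‖ * R)).subset fun g hg => by
      have := hsymm (e (x g))
      rw [e.symm_apply_apply] at this
      exact this.trans (by gcongr; exact hg))
  refine ⟨W.comap e.toLinearMap, ‖(ec.symm : E →L[ℝ] F)‖ * R, fun g => ?_, fun w hw => ?_⟩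
  · obtain ⟨w, hw, hR⟩ := h1 g
    refine ⟨e.symm w, by simpa using hw, ?_⟩
    have := hsymm (e (x g) - w)
    rw [map_sub, e.symm_apply_apply] at this
    exact this.trans (by gcongr)
  · obtain ⟨g, hR⟩ := h2 (e w) hw
    refine ⟨g, ?_⟩
    have := hsymm (e (x g) - e w)
    rw [map_sub, e.symm_apply_apply, e.symm_apply_apply] at this
    exact this.trans (by gcongr)

namespace CartanMotion

variable {V : Type*} [NormedAddCommGroup V] [InnerProductSpace ℝ V] [FiniteDimensional ℝ V]
  {G : Subgroup (V →L[ℝ] V)ˣ}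

/-- The columns of an operator in an orthonormal basis; the Euclidean norm of the columns is the
Hilbert–Schmidt norm. -/
noncomputable def columns (V : Type*) [NormedAddCommGroup V] [InnerProductSpace ℝ V]
    [FiniteDimensional ℝ V] :
    (V →L[ℝ] V) →ₗ[ℝ] PiLp 2 (fun _ : Fin (Module.finrank ℝ V) => V) where
  toFun A := WithLp.toLp 2 fun i => A (stdOrthonormalBasis ℝ V i)
  map_add' _ _ := rfl
  map_smul' _ _ := rfl

theorem inner_columns (A B : V →L[ℝ] V) :
    inner ℝ (columns V A) (columns V B) = traceL (star A * B) := by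
  change _ = LinearMap.trace ℝ V ((star A * B : V →L[ℝ] V) : V →ₗ[ℝ] V)
  rw [LinearMap.trace_eq_sum_inner _ (stdOrthonormalBasis ℝ V), PiLp.inner_apply]
  refine Finset.sum_congr rfl fun i _ => ?_
  change inner ℝ (A _) (B _) = inner ℝ _ (ContinuousLinearMap.adjoint A (B _))
  rw [ContinuousLinearMap.adjoint_inner_right]

theorem columns_injective : Function.Injective (columns V) := by
  rw [← LinearMap.ker_eq_bot, LinearMap.ker_eq_bot']
  intro A hA
  refine eq_zero_of_traceL_star_mul_self ?_
  rw [← inner_columns, hA, inner_zero_left]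

theorem inner_columns_Ad (k : cartanK G) (X Y : cartanP G) :
    inner ℝ (columns V (Ad G k X : V →L[ℝ] V)) (columns V (Ad G k Y : V →L[ℝ] V)) =
      inner ℝ (columns V X) (columns V Y) := by
  rw [inner_columns, inner_columns, cartanP_isSelfAdjoint, cartanP_isSelfAdjoint, Ad_coe, Ad_coe]
  have h : ((k⁻¹ : (V →L[ℝ] V)ˣ) : V →L[ℝ] V) * ((k : (V →L[ℝ] V)ˣ) : V →L[ℝ] V) = 1 := by simp
  rw [mul_assoc, mul_assoc, traceL_mul_comm]
  have e : (X : V →L[ℝ] V) * (((k⁻¹ : (V →L[ℝ] V)ˣ) : V →L[ℝ] V) *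
      (((k : (V →L[ℝ] V)ˣ) : V →L[ℝ] V) * (Y : V →L[ℝ] V) *
        ((k⁻¹ : (V →L[ℝ] V)ˣ) : V →L[ℝ] V))) * ((k : (V →L[ℝ] V)ˣ) : V →L[ℝ] V) =
      (X : V →L[ℝ] V) * (((k⁻¹ : (V →L[ℝ] V)ˣ) : V →L[ℝ] V) * ((k : (V →L[ℝ] V)ˣ) : V →L[ℝ] V)) *
        (Y : V →L[ℝ] V) *
        (((k⁻¹ : (V →L[ℝ] V)ˣ) : V →L[ℝ] V) * ((k : (V →L[ℝ] V)ˣ) : V →L[ℝ] V)) := by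
    simp only [mul_assoc]
  rw [e, h, mul_one, mul_one]

namespace MotionGroup

/-- The translation parts of a discrete subgroup of `G_θ` lie at bounded Hausdorff distance from a
linear subspace of `𝔭`. -/
theorem exists_submodule_near_translations (hG : IsClosed (G : Set (V →L[ℝ] V)ˣ))
    (Γ : Subgroup (MotionGroup G)) [DiscreteTopology Γ] :
    ∃ (W : Submodule ℝ (cartanP G)) (R : ℝ),
      (∀ g : Γ, ∃ w ∈ W, ‖(g : MotionGroup G).X - w‖ ≤ R) ∧
        ∀ w ∈ W, ∃ g : Γ, ‖(g : MotionGroup G).X - w‖ ≤ R := by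
  let kHom : MotionGroup G →* cartanK G := ⟨⟨fun a => a.k, rfl⟩, fun _ _ => rfl⟩
  let Φ : cartanP G →ₗ[ℝ] PiLp 2 (fun _ : Fin (Module.finrank ℝ V) => V) :=
    columns V ∘ₗ (cartanP G).subtype
  have hΦ : Function.Injective Φ := columns_injective.comp (cartanP G).injective_subtype
  exact DiscreteIsometry.exists_submodule_near_orbit_of_linearEquiv
    (LinearEquiv.ofInjective Φ hΦ) (ρ := (Ad G).comp (kHom.comp Γ.subtype))
    (x := fun g : Γ => (g : MotionGroup G).X)
    (fun g v w => inner_columns_Ad _ v w) (fun a b => rfl)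
    (finite_norm_le_of_discrete hG Γ)

/-! ### The `𝔞`-parts of subsets -/

theorem mem_setK_mul_mul_setK {L : Set (MotionGroup G)} {X : cartanP G} :
    ofP X ∈ setK G * L * setK G ↔ ∃ k, ∃ a ∈ L, X = Ad G k a.X := by
  constructor
  · rintro ⟨_, ⟨c, hc, a, ha, rfl⟩, d, hd, h⟩
    refine ⟨c.k, a, ha, ?_⟩
    have := congrArg MotionGroup.X h
    simp only [mul_X, show c.X = 0 from hc, show d.X = 0 from hd, map_zero, add_zero, zero_add,
      ofP_X] at this
    exact this.symm
  · rintro ⟨k, a, ha, rfl⟩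
    refine ⟨_, ⟨⟨k, 0⟩, rfl, a, ha, rfl⟩, ⟨(k * a.k)⁻¹, 0⟩, rfl, ?_⟩
    ext1
    · simp
    · simp

/-- In terms of `K`-orbits, the condition `𝔞(W) ∩ 𝔞(H) = {0}` says that `Ad(K) W` meets the
translation part of `H` only in `0`; this rests on the conjugacy `𝔭 = Ad(K) 𝔞`. -/
theorem aPart_inter_aPart_eq_iff (hG : IsClosed (G : Set (V →L[ℝ] V)ˣ))
    {𝔞 : Submodule ℝ (cartanP G)} (h𝔞 : IsMaximalAbelian 𝔞) {H : Subgroup (MotionGroup G)}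
    {P : Submodule ℝ (cartanP G)} (hP : IsSplit H P) (W : Submodule ℝ (cartanP G)) :
    aPart 𝔞 (ofP '' (W : Set (cartanP G))) ∩ aPart 𝔞 (H : Set (MotionGroup G)) = {0} ↔
      ∀ k, ∀ w ∈ W, Ad G k w ∈ P → w = 0 := by
  constructor
  · intro h k w hw hY
    obtain ⟨l, hl⟩ := exists_Ad_mem hG h𝔞 (Ad G k w)
    have hmem : Ad G l (Ad G k w) ∈
        aPart 𝔞 (ofP '' (W : Set (cartanP G))) ∩ aPart 𝔞 (H : Set (MotionGroup G)) := by
      refine ⟨⟨hl, mem_setK_mul_mul_setK.2 ⟨l * k, ofP w, ⟨w, hw, rfl⟩, ?_⟩⟩,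
        ⟨hl, mem_setK_mul_mul_setK.2 ⟨l, ofP (Ad G k w), hP.ofP_mem_iff.2 hY, rfl⟩⟩⟩
      rw [ofP_X, Ad_mul_apply]
    rw [h, Set.mem_singleton_iff] at hmem
    have h1 := congrArg (Ad G k⁻¹) (congrArg (Ad G l⁻¹) hmem)
    rwa [Ad_inv_Ad, Ad_inv_Ad, map_zero, map_zero] at h1
  · intro h
    refine Set.eq_singleton_iff_unique_mem.2 ⟨?_, ?_⟩
    · exact ⟨⟨𝔞.zero_mem, mem_setK_mul_mul_setK.2
        ⟨1, ofP 0, ⟨0, W.zero_mem, rfl⟩, by rw [ofP_X, map_zero]⟩⟩,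
        ⟨𝔞.zero_mem, mem_setK_mul_mul_setK.2 ⟨1, 1, H.one_mem, by rw [one_X, map_zero]⟩⟩⟩
    · rintro X ⟨⟨-, hX1⟩, ⟨-, hX2⟩⟩
      obtain ⟨k, _, ⟨w, hw, rfl⟩, h1⟩ := mem_setK_mul_mul_setK.1 hX1
      obtain ⟨l, a, ha, h2⟩ := mem_setK_mul_mul_setK.1 hX2
      rw [ofP_X] at h1
      have hmem : Ad G (l⁻¹ * k) w ∈ P := by
        rw [Ad_mul_apply, ← h1, h2, Ad_inv_Ad]
        exact ((hP a).1 ha).2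
      rw [h1, h _ w hw hmem, map_zero]

/-! ### Bounded sets and compactness in quotients -/

section Quotient

variable {H : Subgroup (MotionGroup G)}

theorem exists_norm_lt_of_isCompact {S : Set (MotionGroup G ⧸ H)} (hS : IsCompact S) :
    ∃ R : ℝ, ∀ x ∈ S, ∃ a : MotionGroup G, ‖a.X‖ < R ∧ (a : MotionGroup G ⧸ H) = x := by
  obtain ⟨n, hn⟩ := hS.elim_directed_cover
    (fun n : ℕ => (QuotientGroup.mk : MotionGroup G → MotionGroup G ⧸ H) '' {a | ‖a.X‖ < n})
    (fun n => QuotientGroup.isOpenMap_coe _ (isOpen_norm_lt _))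
    (fun x _ => by
      obtain ⟨a, rfl⟩ := QuotientGroup.mk_surjective x
      obtain ⟨n, hn⟩ := exists_nat_gt ‖a.X‖
      exact Set.mem_iUnion.2 ⟨n, a, hn, rfl⟩)
    (directed_of_isDirected_le fun m n hmn => Set.image_mono fun a ha =>
      (lt_of_lt_of_le (show ‖a.X‖ < m from ha) (Nat.cast_le.2 hmn) : ‖a.X‖ < n))
  exact ⟨n, fun x hx => hn hx⟩

theorem exists_norm_lt_of_compactSpace {Γ : Subgroup (MotionGroup G)}
    [CompactSpace (MulAction.orbitRel.Quotient Γ (MotionGroup G ⧸ H))] :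
    ∃ R : ℝ, ∀ b : MotionGroup G, ∃ γ ∈ Γ, ∃ a : MotionGroup G, ∃ h ∈ H,
      ‖a.X‖ < R ∧ b = γ * a * h := by
  let π : MotionGroup G → MulAction.orbitRel.Quotient Γ (MotionGroup G ⧸ H) :=
    fun a => Quotient.mk _ (a : MotionGroup G ⧸ H)
  have : ContinuousConstSMul Γ (MotionGroup G ⧸ H) :=
    ⟨fun γ => continuous_const_smul (γ : MotionGroup G)⟩
  have hπ : IsOpenMap π :=
    (MulAction.isOpenQuotientMap_quotientMk (Γ := Γ) (T := MotionGroup G ⧸ H)).isOpenMap.comp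
      QuotientGroup.isOpenMap_coe
  have hsurj : Function.Surjective π :=
    Quotient.mk_surjective.comp QuotientGroup.mk_surjective
  obtain ⟨n, hn⟩ := isCompact_univ.elim_directed_cover
    (fun n : ℕ => π '' {a | ‖a.X‖ < n}) (fun n => hπ _ (isOpen_norm_lt _))
    (fun x _ => by
      obtain ⟨a, rfl⟩ := hsurj x
      obtain ⟨n, hn⟩ := exists_nat_gt ‖a.X‖
      exact Set.mem_iUnion.2 ⟨n, a, hn, rfl⟩)
    (directed_of_isDirected_le fun m n hmn => Set.image_mono fun a ha =>
      (lt_of_lt_of_le (show ‖a.X‖ < m from ha) (Nat.cast_le.2 hmn) : ‖a.X‖ < n))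
  refine ⟨n, fun b => ?_⟩
  obtain ⟨a, ha, hab⟩ := hn (Set.mem_univ (π b))
  obtain ⟨γ, hγ⟩ := MulAction.orbitRel_apply.1 (Quotient.exact hab.symm)
  have h1 : ((γ : MotionGroup G) * a : MotionGroup G ⧸ H) = (b : MotionGroup G ⧸ H) := hγ
  refine ⟨γ, γ.2, a, (γ * a)⁻¹ * b, QuotientGroup.eq.1 h1, ha, by group⟩

theorem compactSpace_of_forall_exists (hG : IsClosed (G : Set (V →L[ℝ] V)ˣ))
    {Γ : Subgroup (MotionGroup G)} {R : ℝ} (h : ∀ b : MotionGroup G, ∃ γ ∈ Γ,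
      ∃ a : MotionGroup G, ∃ c ∈ H, ‖a.X‖ ≤ R ∧ b = γ * a * c) :
    CompactSpace (MulAction.orbitRel.Quotient Γ (MotionGroup G ⧸ H)) := by
  let π : MotionGroup G → MulAction.orbitRel.Quotient Γ (MotionGroup G ⧸ H) :=
    fun a => Quotient.mk _ (a : MotionGroup G ⧸ H)
  have hπ : Continuous π := continuous_quot_mk.comp continuous_quot_mk
  have hsurj : Function.Surjective π :=
    Quotient.mk_surjective.comp QuotientGroup.mk_surjective
  refine ⟨((isCompact_norm_le hG R).image hπ).of_isClosed_subset isClosed_univ fun x _ => ?_⟩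
  obtain ⟨b, rfl⟩ := hsurj x
  obtain ⟨γ, hγ, a, c, hc, ha, rfl⟩ := h b
  refine ⟨a, ha, Quotient.sound ((MulAction.orbitRel_apply).2 ⟨⟨γ⁻¹, Γ.inv_mem hγ⟩, ?_⟩)⟩
  change ((γ⁻¹ * (γ * a * c) : MotionGroup G) : MotionGroup G ⧸ H) = (a : MotionGroup G ⧸ H)
  rw [mul_assoc, inv_mul_cancel_left]
  exact QuotientGroup.mk_mul_of_mem a hc

end Quotient

end MotionGroup

end CartanMotion

/-! ### Existence of compact Clifford–Klein forms -/

/-- A subspace `W` contains an additive subgroup that is finite in bounded sets and cobounded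
in `W`. -/
theorem Submodule.exists_lattice {F : Type*} [NormedAddCommGroup F] [NormedSpace ℝ F]
    [FiniteDimensional ℝ F] (W : Submodule ℝ F) :
    ∃ Λ : AddSubgroup F, (∀ l ∈ Λ, l ∈ W) ∧ (∀ R : ℝ, {l | l ∈ Λ ∧ ‖l‖ ≤ R}.Finite) ∧
      ∃ R : ℝ, ∀ w ∈ W, ∃ l ∈ Λ, ‖w - l‖ ≤ R := by
  let b := Module.finBasis ℝ W
  let Λ : Submodule ℤ W := Submodule.span ℤ (Set.range b)
  refine ⟨Λ.toAddSubgroup.map W.subtype.toAddMonoidHom, ?_, fun R => ?_, ?_⟩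
  · rintro _ ⟨l, -, rfl⟩
    exact l.2
  · have h1 : (Metric.closedBall (0 : W) R ∩ (Λ : Set W)).Finite :=
      ZSpan.setFinite_inter b Metric.isBounded_closedBall
    refine (h1.image W.subtype).subset ?_
    rintro _ ⟨⟨l, hl, rfl⟩, hR⟩
    exact ⟨l, ⟨mem_closedBall_zero_iff.2 hR, hl⟩, rfl⟩
  · obtain ⟨R, hR⟩ := DiscreteIsometry.exists_bound_span_addSubgroup Λ.toAddSubgroup
    have hspan : Submodule.span ℝ (Λ.toAddSubgroup : Set W) = ⊤ := by
      rw [eq_top_iff, ← b.span_eq]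
      exact Submodule.span_mono Submodule.subset_span
    refine ⟨R, fun w hw => ?_⟩
    obtain ⟨l, hl, hlR⟩ := hR ⟨w, hw⟩ (by rw [hspan]; trivial)
    exact ⟨l, ⟨l, hl, rfl⟩, hlR⟩

namespace CartanMotion.MotionGroup

open Filter Topology

variable {V : Type*} [NormedAddCommGroup V] [InnerProductSpace ℝ V] [FiniteDimensional ℝ V]
  {G : Subgroup (V →L[ℝ] V)ˣ} {H : Subgroup (MotionGroup G)} {P W : Submodule ℝ (cartanP G)}

/-- Transversality of `W` to all `K`-translates of `P` is uniform, by compactness of `K` and of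
the unit sphere of `W`. -/
theorem exists_pos_mul_norm_le (hG : IsClosed (G : Set (V →L[ℝ] V)ˣ))
    (hW : ∀ k, ∀ w ∈ W, Ad G k w ∈ P → w = 0) :
    ∃ c > 0, ∀ k, ∀ w ∈ W, ∀ Y ∈ P, c * ‖w‖ ≤ ‖Ad G k w + Y‖ := by
  have := compactSpace_cartanK hG
  have hWcl : IsClosed (W : Set (cartanP G)) := W.closed_of_finiteDimensional
  have hPcl : IsClosed (P : Set (cartanP G)) := P.closed_of_finiteDimensional
  have hPne : (P : Set (cartanP G)).Nonempty := ⟨0, P.zero_mem⟩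
  have hcomp : IsCompact ((Set.univ : Set (cartanK G)) ×ˢ
      (Metric.sphere (0 : cartanP G) 1 ∩ (W : Set (cartanP G)))) :=
    isCompact_univ.prod ((isCompact_sphere _ _).inter_right hWcl)
  have hcont : Continuous fun q : cartanK G × cartanP G =>
      Metric.infDist (Ad G q.1 q.2) (P : Set (cartanP G)) :=
    (Metric.continuous_infDist_pt _).comp continuous_Ad
  obtain ⟨c, hc, hcle⟩ := hcomp.exists_forall_le' hcont.continuousOn (a := 0) (by
    rintro ⟨k, w⟩ ⟨-, hw, hwW⟩
    refine (hPcl.notMem_iff_infDist_pos hPne).1 fun hmem => ?_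
    rw [hW k w hwW hmem] at hw
    have h0 : ‖(0 : cartanP G)‖ = 1 := mem_sphere_zero_iff_norm.1 hw
    rw [show ‖(0 : cartanP G)‖ = 0 from norm_zero] at h0
    exact zero_ne_one h0)
  refine ⟨c, hc, fun k w hw Y hY => ?_⟩
  rcases eq_or_ne w 0 with rfl | hne
  · rw [show ‖(0 : cartanP G)‖ = 0 from norm_zero, mul_zero]
    exact norm_nonneg _
  have hpos : 0 < ‖w‖ := norm_pos_iff.2 hne
  have hunit : ‖‖w‖⁻¹ • w‖ = 1 := by
    rw [norm_smul_cartanP, abs_of_pos (inv_pos.2 hpos), inv_mul_cancel₀ hpos.ne']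
  have h1 := hcle (k, ‖w‖⁻¹ • w) ⟨Set.mem_univ _, mem_sphere_zero_iff_norm.2 hunit,
    W.smul_mem _ hw⟩
  have h2 : Metric.infDist (Ad G k (‖w‖⁻¹ • w)) (P : Set (cartanP G)) ≤
      ‖Ad G k (‖w‖⁻¹ • w) - -(‖w‖⁻¹ • Y)‖ :=
    (Metric.infDist_le_dist_of_mem (P.neg_mem (P.smul_mem _ hY))).trans_eq (dist_eq_norm _ _)
  rw [map_smul, sub_neg_eq_add, ← smul_add, norm_smul_cartanP, abs_of_pos (inv_pos.2 hpos)] at h2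
  have h3 : c ≤ ‖w‖⁻¹ * ‖Ad G k w + Y‖ := by
    refine h1.trans ?_
    rw [map_smul]
    exact h2
  rwa [inv_mul_eq_div, le_div_iff₀ hpos] at h3

/-- A subgroup meeting each bounded set in a finite set is discrete. -/
theorem discreteTopology_of_finite {Γ : Subgroup (MotionGroup G)}
    (hfin : ∀ R : ℝ, {g : Γ | ‖(g : MotionGroup G).X‖ ≤ R}.Finite) : DiscreteTopology Γ := by
  refine discreteTopology_of_isOpen_singleton_one ?_
  have hU : IsOpen {g : Γ | ‖(g : MotionGroup G).X‖ < 1} :=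
    (isOpen_norm_lt 1).preimage continuous_subtype_val
  have hF : ({g : Γ | ‖(g : MotionGroup G).X‖ < 1} \ {1}).Finite :=
    (hfin 1).subset fun g hg => (le_of_lt hg.1 : ‖(g : MotionGroup G).X‖ ≤ 1)
  have e : ({1} : Set Γ) = {g : Γ | ‖(g : MotionGroup G).X‖ < 1} \
      ({g : Γ | ‖(g : MotionGroup G).X‖ < 1} \ {1}) := by
    rw [Set.sdiff_sdiff_right_self, eq_comm, Set.inter_eq_right, Set.singleton_subset_iff]
    change ‖(0 : cartanP G)‖ < 1
    rw [show ‖(0 : cartanP G)‖ = 0 from norm_zero]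
    exact one_pos
  rw [e]
  exact hU.sdiff hF.isClosed

/-- The translations by a lattice in a complement `W` that is transversal to all `K`-translates of
`P` give a compact Clifford–Klein form. -/
theorem hasCompactCliffordKleinForm_of_complement (hG : IsClosed (G : Set (V →L[ℝ] V)ˣ))
    (hP : IsSplit H P) (hW : ∀ k, ∀ w ∈ W, Ad G k w ∈ P → w = 0)
    (hdim : Module.finrank ℝ W + Module.finrank ℝ P = Module.finrank ℝ (cartanP G)) :
    HasCompactCliffordKleinForm H := by
  obtain ⟨Λ, hΛW, hΛfin, R, hΛR⟩ := Submodule.exists_lattice (F := cartanP G) W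
  let Γ : Subgroup (MotionGroup G) :=
    { carrier := {a | ∃ l ∈ Λ, ofP l = a}
      one_mem' := ⟨0, Λ.zero_mem, rfl⟩
      mul_mem' := by
        rintro _ _ ⟨l, hl, rfl⟩ ⟨m, hm, rfl⟩
        exact ⟨l + m, Λ.add_mem hl hm, ofP_add _ _⟩
      inv_mem' := by
        rintro _ ⟨l, hl, rfl⟩
        exact ⟨-l, Λ.neg_mem hl, ofP_neg _⟩ }
  have hΓ : ∀ γ ∈ Γ, γ.X ∈ W ∧ γ = ofP γ.X := by
    rintro _ ⟨l, hl, rfl⟩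
    exact ⟨hΛW l hl, rfl⟩
  have hfin : ∀ R : ℝ, {g : Γ | ‖(g : MotionGroup G).X‖ ≤ R}.Finite := by
    intro R
    refine Set.Finite.of_finite_image (((hΛfin R).image ofP).subset ?_)
      Subtype.val_injective.injOn
    rintro _ ⟨⟨_, l, hl, rfl⟩, hg, rfl⟩
    exact ⟨l, ⟨hl, hg⟩, rfl⟩
  -- a translation moving a coset within a bounded set is bounded
  have hmove : ∀ γ ∈ Γ, ∀ a c : MotionGroup G,
      ((γ * a : MotionGroup G) : MotionGroup G ⧸ H) = (c : MotionGroup G ⧸ H) →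
      ∃ Y ∈ P, Ad G a.k⁻¹ γ.X + Y = Ad G a.k⁻¹ (c.X - a.X) := by
    intro γ hγ a c h
    have hmem := QuotientGroup.eq.1 h
    obtain ⟨y, hy, hc⟩ : ∃ y ∈ H, c = γ * a * y := ⟨_, hmem, by group⟩
    refine ⟨y.X, ((hP y).1 hy).2, ?_⟩
    rw [hc, (hΓ γ hγ).2]
    simp only [mul_X, mul_k, ofP_X, ofP_k, one_mul, map_one, Module.End.one_apply]
    rw [add_sub_right_comm, add_sub_cancel_right, map_add, Ad_inv_Ad]
  refine ⟨Γ, discreteTopology_of_finite hfin, ⟨fun {S T} hS hT => ?_⟩, fun γ x hx => ?_, ?_⟩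
  · obtain ⟨c, hc, hbound⟩ := exists_pos_mul_norm_le hG hW
    obtain ⟨R₁, h1⟩ := exists_norm_lt_of_isCompact hS
    obtain ⟨R₂, h2⟩ := exists_norm_lt_of_isCompact hT
    refine (hfin ((R₂ + R₁) / c)).subset ?_
    rintro γ ⟨_, ⟨s, hs, rfl⟩, ht⟩
    obtain ⟨a, ha, rfl⟩ := h1 s hs
    obtain ⟨d, hd, hda⟩ := h2 _ ht
    obtain ⟨Y, hY, hYe⟩ := hmove γ γ.2 a d hda.symm
    have h3 := hbound a.k⁻¹ _ (hΓ γ γ.2).1 Y hY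
    rw [hYe, norm_Ad] at h3
    have h4 : ‖d.X - a.X‖ ≤ ‖d.X‖ + ‖a.X‖ := norm_sub_le _ _
    change ‖(γ : MotionGroup G).X‖ ≤ _
    rw [le_div_iff₀ hc, mul_comm]
    linarith
  · obtain ⟨a, rfl⟩ := QuotientGroup.mk_surjective x
    obtain ⟨Y, hY, hYe⟩ := hmove γ γ.2 a a hx
    rw [sub_self, map_zero] at hYe
    have hX : (γ : MotionGroup G).X = 0 := hW a.k⁻¹ _ (hΓ γ γ.2).1 (by
      rw [eq_neg_of_add_eq_zero_left hYe]
      exact P.neg_mem hY)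
    refine Subtype.ext ((hΓ γ γ.2).2.trans ?_)
    rw [hX]
    rfl
  · refine compactSpace_of_forall_exists hG (R := R) fun a => ?_
    have hker : ∀ v, Ad G a.k v = 0 → v = 0 := fun v hv => by
      have := congrArg (Ad G a.k⁻¹) hv
      rwa [Ad_inv_Ad, map_zero] at this
    have hinj : Function.Injective (Ad G a.k) :=
      LinearMap.ker_eq_bot.1 (LinearMap.ker_eq_bot'.2 hker)
    have htop : W ⊔ P.map (Ad G a.k) = ⊤ := by
      refine Submodule.eq_top_of_disjoint _ _ ?_ ?_
      · rw [← (Submodule.equivMapOfInjective _ hinj P).finrank_eq, hdim]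
      · rw [Submodule.disjoint_def]
        rintro _ hw ⟨Y, hY, rfl⟩
        exact hW a.k⁻¹ _ hw (by rwa [Ad_inv_Ad])
    have hmem : a.X ∈ W ⊔ P.map (Ad G a.k) := by rw [htop]; trivial
    obtain ⟨w, hw, _, ⟨Y, hY, rfl⟩, hsum⟩ := Submodule.mem_sup.1 hmem
    obtain ⟨l, hl, hlR⟩ := hΛR w hw
    refine ⟨ofP l, ⟨l, hl, rfl⟩, ⟨a.k, w - l⟩, ofP Y, hP.ofP_mem_iff.2 hY, hlR, ?_⟩
    ext1
    · simp
    · simp [hsum]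

/-- For a compact Clifford–Klein form with group `Γ`, the subspace near the translation parts of
`Γ` is transversal to all `K`-translates of `P` by properness, and complementary to `P` by
cocompactness. -/
theorem exists_complement_of_hasCompactCliffordKleinForm
    (hG : IsClosed (G : Set (V →L[ℝ] V)ˣ)) (hP : IsSplit H P)
    (hCK : HasCompactCliffordKleinForm H) :
    ∃ W : Submodule ℝ (cartanP G), (∀ k, ∀ w ∈ W, Ad G k w ∈ P → w = 0) ∧
      Module.finrank ℝ W + Module.finrank ℝ P = Module.finrank ℝ (cartanP G) := by
  obtain ⟨Γ, hdisc, hprop, -, hcomp⟩ := hCK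
  obtain ⟨W, R, hnear, hfar⟩ := exists_submodule_near_translations hG Γ
  have htrans : ∀ k, ∀ w ∈ W, Ad G k w ∈ P → w = 0 := by
    intro k w hw hY
    by_contra hne
    have hpos : 0 < ‖w‖ := norm_pos_iff.2 hne
    let S : Set (MotionGroup G ⧸ H) := (QuotientGroup.mk : MotionGroup G → MotionGroup G ⧸ H) ''
      {a | ‖a.X‖ ≤ R}
    have hS : IsCompact S := (isCompact_norm_le hG R).image continuous_quot_mk
    have hfinite := hprop.finite_disjoint_inter_image hS hS
    obtain ⟨M, hM⟩ := (hfinite.image fun γ : Γ => ‖(γ : MotionGroup G).X‖).bddAbove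
    obtain ⟨n, hn⟩ := exists_nat_gt ((M + R) / ‖w‖)
    obtain ⟨γ, hγ⟩ := hfar ((n : ℝ) • w) (W.smul_mem _ hw)
    have hR0 : 0 ≤ R := (norm_nonneg _).trans hγ
    -- `γ` moves the coset of a rotation to the coset of `(k⁻¹, b)`, as `n w ∈ Ad(k⁻¹) P`
    have hmem : ‖(γ : MotionGroup G).X‖ ≤ M := by
      refine hM ⟨γ, ⟨_, ⟨_, ⟨⟨(γ : MotionGroup G).k⁻¹ * k⁻¹, 0⟩, ?_, rfl⟩, rfl⟩,
        ⟨⟨k⁻¹, (γ : MotionGroup G).X - (n : ℝ) • w⟩, hγ, ?_⟩⟩, rfl⟩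
      · change ‖(0 : cartanP G)‖ ≤ R
        rwa [show ‖(0 : cartanP G)‖ = 0 from norm_zero]
      · change _ = (((γ : MotionGroup G) * ⟨(γ : MotionGroup G).k⁻¹ * k⁻¹, 0⟩ : MotionGroup G) :
          MotionGroup G ⧸ H)
        have e : (γ : MotionGroup G) * ⟨(γ : MotionGroup G).k⁻¹ * k⁻¹, 0⟩ =
            ⟨k⁻¹, (γ : MotionGroup G).X - (n : ℝ) • w⟩ * ofP ((n : ℝ) • Ad G k w) := by
          ext1
          · simp
          · simp
        rw [e, QuotientGroup.mk_mul_of_mem _ (hP.ofP_mem_iff.2 (P.smul_mem _ hY))]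
    have h1 : ‖(n : ℝ) • w‖ ≤ ‖(γ : MotionGroup G).X‖ + ‖(γ : MotionGroup G).X - (n : ℝ) • w‖ :=
      norm_le_insert _ _
    rw [norm_smul_cartanP, Nat.abs_cast] at h1
    rw [div_lt_iff₀ hpos] at hn
    linarith
  refine ⟨W, htrans, ?_⟩
  have htop : W ⊔ P = ⊤ := by
    obtain ⟨R', hR'⟩ := exists_norm_lt_of_compactSpace (H := H) (Γ := Γ)
    refine Submodule.eq_top_of_forall_exists_norm_sub_le (E := cartanP G) (R := R + R') fun Z => ?_
    obtain ⟨γ, hγ, a, h, hh, ha, he⟩ := hR' (ofP Z)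
    obtain ⟨w, hw, hwR⟩ := hnear ⟨γ, hγ⟩
    have hk : γ.k * a.k = h.k⁻¹ := by
      have := congrArg MotionGroup.k he
      rw [ofP_k, mul_k, mul_k] at this
      exact eq_inv_of_mul_eq_one_left this.symm
    have hX : Z = γ.X + Ad G γ.k a.X + Ad G h.k⁻¹ h.X := by
      have := congrArg MotionGroup.X he
      rwa [ofP_X, mul_X, mul_X, mul_k, hk] at this
    have hYP : Ad G h.k⁻¹ h.X ∈ P := hP.Ad_mem (H.inv_mem hh) ((hP h).1 hh).2
    refine ⟨w + Ad G h.k⁻¹ h.X, Submodule.add_mem_sup hw hYP, ?_⟩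
    have e : Z - (w + Ad G h.k⁻¹ h.X) = (γ.X - w) + Ad G γ.k a.X := by rw [hX]; abel
    rw [e]
    exact (norm_add_le _ _).trans (add_le_add hwR ((norm_Ad _ _).trans_le ha.le))
  have hinf : W ⊓ P = ⊥ := by
    rw [eq_bot_iff]
    rintro w ⟨hw, hwP⟩
    exact htrans 1 w hw (by rwa [map_one])
  have := Submodule.finrank_sup_add_finrank_inf_eq W P
  rw [htop, hinf, finrank_bot, finrank_top, add_zero] at this
  exact this.symm

end CartanMotion.MotionGroup

open CartanMotion CartanMotion.MotionGroup in
theorem mainTheorem4 {V : Type*} [NormedAddCommGroup V] [InnerProductSpace ℝ V]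
    [FiniteDimensional ℝ V] (G : Subgroup (V →L[ℝ] V)ˣ) (hG : IsLinearReductive G)
    (𝔞 : Submodule ℝ (cartanP G)) (h𝔞 : IsMaximalAbelian 𝔞)
    (H : Subgroup (MotionGroup G)) (hHclosed : IsClosed (H : Set (MotionGroup G)))
    (hHcomp : Finite (ConnectedComponents H))
    (hHstable : ∀ h ∈ H, thetaBar h ∈ H) :
    HasCompactCliffordKleinForm H ↔
      ∃ W : Submodule ℝ (cartanP G),
        aPart 𝔞 (ofP '' (W : Set (cartanP G))) ∩ aPart 𝔞 (H : Set (MotionGroup G)) = {0} ∧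
        Module.finrank ℝ W + noncompactDim H = noncompactDim (⊤ : Subgroup (MotionGroup G)) := by
  obtain ⟨P, hP⟩ := exists_isSplit hHclosed hHcomp hHstable
  rw [hP.noncompactDim_eq hG.isClosed hHclosed,
    isSplit_top.noncompactDim_eq hG.isClosed isClosed_univ, finrank_top]
  simp only [aPart_inter_aPart_eq_iff hG.isClosed h𝔞 hP]
  exact ⟨exists_complement_of_hasCompactCliffordKleinForm hG.isClosed hP,
    fun ⟨_, hW, hdim⟩ => hasCompactCliffordKleinForm_of_complement hG.isClosed hP hW hdim⟩
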